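/- Let $A$ be a finite alphabet and $d\ge 1$. Let $Y\subset A^{\mathbb Z^d}$ be a subshift of finite type, i.e. the set of configurations containing no translate of any pattern from some finite set of finite patterns. Let $f:Y\to\mathbb Q$ be a simple continuous function (continuous with finitely many values), and let $L\subset\mathbb Z^d$ be a subgroup of rank $d-1$. Write $\sigma_{\vec v}(x)_{\vec n}=x_{\vec n+\vec v}$, let $Y_L=\{x\in Y : \sigma_{\vec v}(x)=x \text{ for all } \vec v\in L\}$ be the set of $L$-periodic configurations of $Y$, and assume $Y_L\neq\emptyset$. For $x\in Y_L$ let \[ \delta_f(x)=\lim_{n\to\infty}\frac{1}{(2n+1)^d}\sum_{\vec v\in[-n,n]^d} f(\sigma_{\vec v}(x)) \] if this limit exists, and $\delta_f(x)=\infty$ otherwise. Then $\delta_f(Y_L)=\inf_{x\in Y_L}\delta_f(x)$ is a rational number, attained by some $x\in Y_L$, and it is exactly computable from the descriptions of $Y$, $f$ and $L$: there is a single algorithm which, given $d$, $|A|$, any finite list of forbidden patterns defining $Y$, any finite table describing $f$ (pairs of a finite pattern and a rational value such that every $x\in Y$ agrees with at least one pattern of the table on that pattern's domain, and $f(x)$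 is the value listed with every such pattern), and any finite list of generators of $L$, halts and outputs the rational number $\delta_f(Y_L)$. (On other inputs the algorithm may do anything.) -/

import Mathlib

open Filter Topology SymbolicDynamics.FullShift

universe u

namespace PeriodicDensity

/-- `Y` is a shift of finite type: it is defined by a finite set of forbidden finite patterns. -/
def IsSFT {d : ℕ} {A : Type*} [TopologicalSpace A] [Inhabited A]
    (Y : Subshift A (Fin d → ℤ)) : Prop :=
  ∃ F : Set (Pattern A (Fin d → ℤ)), F.Finite ∧ Y.carrier = forbidden F

/-- A simple continuous function: continuous, and constant on each piece of some finite partition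
of its domain (that is, with finitely many values). -/
def IsSimpleContinuous {X Z : Type*} [TopologicalSpace X] [TopologicalSpace Z] (f : X → Z) : Prop :=
  Continuous f ∧ (Set.range f).Finite

/-- The shift by `v`, as a map from a subshift to itself. -/
def shiftOn {d : ℕ} {A : Type*} [TopologicalSpace A] (X : Subshift A (Fin d → ℤ))
    (v : Fin d → ℤ) (x : X.carrier) : X.carrier :=
  ⟨shift v x.1, X.mapsTo v x.2⟩

/-- `a` is the `f`-density of `x`, i.e. the limit of the averages of `f` over the shifts of `x` by
the vectors of the hypercubes `[-n, n]^d`. -/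
def HasDensity {d : ℕ} {A : Type*} [TopologicalSpace A] (X : Subshift A (Fin d → ℤ))
    (f : X.carrier → ℝ) (x : X.carrier) (a : ℝ) : Prop :=
  Tendsto (fun n : ℕ =>
      (∑ v ∈ Finset.Icc (fun _ : Fin d => -(n : ℤ)) (fun _ : Fin d => (n : ℤ)),
        f (shiftOn X v x)) / (2 * (n : ℝ) + 1) ^ d)
    atTop (𝓝 a)

open Classical in
/-- The `f`-density of `x`, evaluated to `∞` when the limit does not exist. -/
noncomputable def density {d : ℕ} {A : Type*} [TopologicalSpace A] (X : Subshift A (Fin d → ℤ))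
    (f : X.carrier → ℝ) (x : X.carrier) : EReal :=
  if h : ∃ a : ℝ, HasDensity X f x a then ((h.choose : ℝ) : EReal) else ⊤

/-- The minimum density of `f` in `X`. -/
noncomputable def minDensity {d : ℕ} {A : Type*} [TopologicalSpace A]
    (X : Subshift A (Fin d → ℤ)) (f : X.carrier → ℝ) : EReal :=
  ⨅ x : X.carrier, density X f x

/-- The subshift of the `L`-periodic configurations of `Y`. -/
def periodicPart {d : ℕ} {A : Type*} [TopologicalSpace A] [T2Space A]
    (Y : Subshift A (Fin d → ℤ)) (L : AddSubgroup (Fin d → ℤ)) : Subshift A (Fin d → ℤ) where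
  carrier := {x | x ∈ Y.carrier ∧ ∀ v ∈ L, x = shift v x}
  isClosed := by
    have h : {x | x ∈ Y.carrier ∧ ∀ v ∈ L, x = shift v x}
        = Y.carrier ∩ ⋂ v ∈ L, {x | x = shift v x} := by
      ext x; simp
    rw [h]
    exact Y.isClosed.inter (isClosed_biInter fun v _ =>
      isClosed_eq continuous_id (continuous_shift v))
  mapsTo := by
    rintro g x ⟨hx, hp⟩
    refine ⟨Y.mapsTo g hx, fun v hv => ?_⟩
    funext u
    have := congrFun (hp v hv) (g + u)
    simp only [shift_apply] at this ⊢
    rw [this]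
    congr 1
    abel

/-- A function on `Y`, restricted to the `L`-periodic configurations and read as real-valued. -/
def restrictPeriodic {d : ℕ} {A : Type*} [TopologicalSpace A] [T2Space A]
    (Y : Subshift A (Fin d → ℤ)) (L : AddSubgroup (Fin d → ℤ)) (f : Y.carrier → ℚ) :
    (periodicPart Y L).carrier → ℝ :=
  fun x => ((f ⟨x.1, x.2.1⟩ : ℚ) : ℝ)

/-! ### Finite descriptions, as inputs of algorithms

A vector of `ℤ^d` is written as the list of its coordinates, a symbol as its number in an
enumeration of the alphabet, a finite pattern as a list of (position, symbol) entries, and a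
rational number as a pair (numerator, nonzero denominator). -/

/-- A written pattern. -/
abbrev PatternCode : Type := List (List ℤ × ℕ)

/-- A written rational number, (numerator, denominator). -/
abbrev RatCode : Type := ℤ × ℕ

/-- A written input: the dimension, the size of the alphabet, a list of forbidden patterns, a table
for the function, and a list of generators of the subgroup. -/
abbrev InputCode : Type :=
  ℕ × ℕ × List PatternCode × List (PatternCode × RatCode) × List (List ℤ)

/-- The written rational `c` stands for the rational number `q`. -/
def RatCode.Describes (c : RatCode) (q : ℚ) : Prop :=
  c.2 ≠ 0 ∧ q = (c.1 : ℚ) / (c.2 : ℚ)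

/-- The list `c` consists of the (position, symbol) entries of the pattern `P`, in any order. -/
def PatternCode.Describes {d k : ℕ} {A : Type*} [Inhabited A] (e : A ≃ Fin k)
    (c : PatternCode) (P : Pattern A (Fin d → ℤ)) : Prop :=
  ∀ t : List ℤ × ℕ, t ∈ c ↔ ∃ v ∈ P.support, t = (List.ofFn v, (e (P.config v) : ℕ))

/-- A subshift of finite type is described by a finite list of forbidden patterns defining it. -/
def DescribesSFT {d k : ℕ} {A : Type*} [TopologicalSpace A] [Inhabited A] (e : A ≃ Fin k)
    (c : List PatternCode) (Y : Subshift A (Fin d → ℤ)) : Prop :=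
  ∃ F : List (Pattern A (Fin d → ℤ)),
    List.Forall₂ (PatternCode.Describes e) c F ∧ Y.carrier = forbidden {P | P ∈ F}

/-- A function on `Y` is described by a finite table of pairs (pattern, value): every configuration
of `Y` lies in the cylinder of some pattern of the table, and the function takes on each cylinder
the value listed with it. -/
def DescribesFun {d k : ℕ} {A : Type*} [TopologicalSpace A] [Inhabited A] (e : A ≃ Fin k)
    (c : List (PatternCode × RatCode)) (Y : Subshift A (Fin d → ℤ)) (f : Y.carrier → ℚ) : Prop :=
  ∃ T : List (Pattern A (Fin d → ℤ) × ℚ),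
    List.Forall₂ (fun s t => PatternCode.Describes e s.1 t.1 ∧ RatCode.Describes s.2 t.2) c T ∧
    (∀ x : Y.carrier, ∃ t ∈ T, t.1.occursInAt x.1 0) ∧
    (∀ x : Y.carrier, ∀ t ∈ T, t.1.occursInAt x.1 0 → f x = t.2)

/-- A subgroup of `ℤ^d` is described by a finite list of generators. -/
def DescribesSubgroup {d : ℕ} (c : List (List ℤ)) (L : AddSubgroup (Fin d → ℤ)) : Prop :=
  ∃ G : List (Fin d → ℤ), c = G.map List.ofFn ∧ L = AddSubgroup.closure {v | v ∈ G}

/-- `w` is a description of the subshift of finite type `Y`, the function `f` and the subgroup `L`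
(with respect to some enumeration of the alphabet). -/
def Describes {d : ℕ} {A : Type*} [TopologicalSpace A] [Inhabited A] (w : InputCode)
    (Y : Subshift A (Fin d → ℤ)) (f : Y.carrier → ℚ) (L : AddSubgroup (Fin d → ℤ)) : Prop :=
  ∃ (k : ℕ) (e : A ≃ Fin k) (cY : List PatternCode) (cf : List (PatternCode × RatCode))
    (cL : List (List ℤ)), w = (d, k, cY, cf, cL) ∧
      DescribesSFT e cY Y ∧ DescribesFun e cf Y f ∧ DescribesSubgroup cL L

end PeriodicDensity

/-! Modulo `L` the lattice is essentially one-dimensional, so minimizing the density is a minimum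
mean cycle problem on a finite graph.

Choose a vector `u` and a functional `φ` that vanishes on `L`, with `φ u > 0`
(`exists_transversal`). Every point of a slab `|φ| ≤ K` is congruent modulo `L` to a point of a
fixed box, so an `L`-periodic configuration has only finitely many possible restrictions to a slab;
these are the states of the graph. For `K` large, the forbidden patterns, the periods in `L` and the
value of `f` are all visible inside a slab, so configurations may be cut and pasted wherever two
slabs agree. By pigeonhole, equal slabs occur within boundedly many steps along `u`
(`exists_equal_slabs`). The piece between them can be repeated forever, giving a periodic
configuration (`IsLocalAlong.exists_periodic`), or removed (`IsLocalAlong.exists_excision`).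

Peeling off such cycles one after another shows that if every short cycle has mean at least `q`,
then the sum over an orbit segment of length `n` is at least `n * q` up to a constant
(`IsLocalAlong.sum_ge`). Hence every existing density is at least the smallest mean of a short
cycle. All short cycles come from configurations with one common period `M` in every coordinate
direction (`commonPeriod_spec`). There are finitely many of these, and each has a rational density,
so the minimum is rational and attained.

For computability, `M` is a primitive recursive function of a bound for the dimension, the alphabet
and all coordinates, and the code number of the input, plus one, is such a bound. The `M`-periodic
configurations are numbered by their base `k` digits, and values are rescaled to natural numbers. An
unbounded search for the least total attained by a valid configuration then returns the minimum
(`minDensityAlgorithm_spec`). -/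

namespace PeriodicDensity

/-! ### Averages over large boxes and their invariance under translation. -/

section Averages

variable {d : ℕ}

/-- The average of `g` over the hypercube `[-n, n]^d`. -/
noncomputable def boxAverage (g : (Fin d → ℤ) → ℝ) (n : ℕ) : ℝ :=
  (∑ v ∈ Finset.Icc (fun _ : Fin d => -(n : ℤ)) (fun _ : Fin d => (n : ℤ)), g v) /
    (2 * (n : ℝ) + 1) ^ d

lemma card_box (d n : ℕ) :
    ((Finset.Icc (fun _ : Fin d => -(n : ℤ)) (fun _ : Fin d => (n : ℤ))).card : ℝ) =
      (2 * (n : ℝ) + 1) ^ d := by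
  have h : ((n : ℤ) + 1 + (n : ℤ)).toNat = 2 * n + 1 := by omega
  rw [Pi.card_Icc]
  simp [h]

lemma abs_sum_sub_sum_le_of_subset {V : Type*} {g : V → ℝ} {C : ℝ} (hg : ∀ v, |g v| ≤ C)
    {S T : Finset V} (h : S ⊆ T) :
    |∑ v ∈ T, g v - ∑ v ∈ S, g v| ≤ C * ((T.card : ℝ) - S.card) := by
  classical
  rw [← Finset.sum_sdiff h, add_sub_cancel_right, ← Nat.cast_sub (Finset.card_le_card h),
    ← Finset.card_sdiff_of_subset h]
  calc |∑ v ∈ T \ S, g v| ≤ ∑ v ∈ T \ S, |g v| := Finset.abs_sum_le_sum_abs _ _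
    _ ≤ ∑ v ∈ T \ S, C := Finset.sum_le_sum fun v _ => hg v
    _ = C * ((T \ S).card : ℝ) := by simp [mul_comm]

/-- A box and its translate both lie in a box enlarged by a constant `r`, and the added shell has
negligible volume relative to the box. -/
lemma tendsto_boxAverage_translate_sub {g : (Fin d → ℤ) → ℝ} {C : ℝ} (hg : ∀ v, |g v| ≤ C)
    (w : Fin d → ℤ) :
    Tendsto (fun n => boxAverage (fun v => g (v + w)) n - boxAverage g n) atTop (𝓝 0) := by
  classical
  obtain ⟨r, hr⟩ : ∃ r : ℕ, ∀ j, |w j| ≤ r := by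
    refine ⟨∑ j, (w j).natAbs, fun j => ?_⟩
    rw [Int.abs_eq_natAbs]
    exact_mod_cast Finset.single_le_sum (f := fun j => (w j).natAbs) (fun _ _ => Nat.zero_le _)
      (Finset.mem_univ j)
  have key : ∀ n : ℕ, |boxAverage (fun v => g (v + w)) n - boxAverage g n| ≤
      2 * C * ((1 + 2 * r / (2 * (n : ℝ) + 1)) ^ d - 1) := by
    intro n
    set S := Finset.Icc (fun _ : Fin d => -(n : ℤ)) (fun _ : Fin d => (n : ℤ)) with hS
    set T := Finset.Icc (fun _ : Fin d => -((n + r : ℕ) : ℤ)) (fun _ : Fin d => ((n + r : ℕ) : ℤ))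
      with hT
    set S' := S.map (addRightEmbedding w) with hS'
    have h1 : S ⊆ T := by
      intro v hv
      simp only [hS, hT, Finset.mem_Icc, Pi.le_def] at hv ⊢
      push_cast
      exact ⟨fun j => by have := hv.1 j; omega, fun j => by have := hv.2 j; omega⟩
    have h2 : S' ⊆ T := by
      intro v hv
      simp only [hS', Finset.mem_map, addRightEmbedding_apply] at hv
      obtain ⟨v, hv, rfl⟩ := hv
      simp only [hS, hT, Finset.mem_Icc, Pi.le_def, Pi.add_apply] at hv ⊢
      push_cast
      exact ⟨fun j => by have := hv.1 j; have := abs_le.1 (hr j); omega,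
        fun j => by have := hv.2 j; have := abs_le.1 (hr j); omega⟩
    have h3 : ∑ v ∈ S, g (v + w) = ∑ v ∈ S', g v := by
      rw [hS', Finset.sum_map]; rfl
    have h4 := abs_sum_sub_sum_le_of_subset hg h1
    have h5 := abs_sum_sub_sum_le_of_subset hg h2
    have h6 : S'.card = S.card := Finset.card_map _
    have hSc : (S.card : ℝ) = (2 * (n : ℝ) + 1) ^ d := card_box d n
    have hTc : (T.card : ℝ) = (2 * (n : ℝ) + 1 + 2 * r) ^ d := by
      rw [hT, card_box]; push_cast; ring
    have hpos : (0 : ℝ) < 2 * (n : ℝ) + 1 := by positivity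
    have h7 : |∑ v ∈ S, g (v + w) - ∑ v ∈ S, g v| ≤
        2 * C * ((2 * (n : ℝ) + 1 + 2 * r) ^ d - (2 * (n : ℝ) + 1) ^ d) := by
      rw [h3]
      rw [h6] at h5
      rw [hSc, hTc] at h4 h5
      rw [abs_le] at h4 h5 ⊢
      constructor <;> linarith [h4.1, h4.2, h5.1, h5.2]
    unfold boxAverage
    rw [← hS, ← sub_div, abs_div, abs_of_pos (pow_pos hpos d), div_le_iff₀ (pow_pos hpos d)]
    refine h7.trans_eq ?_
    rw [mul_assoc (2 * C), sub_mul, ← mul_pow, one_mul, add_mul, div_mul_cancel₀ _ hpos.ne', one_mul]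
  have hlim : Tendsto (fun n : ℕ => 2 * C * ((1 + 2 * r / (2 * (n : ℝ) + 1)) ^ d - 1)) atTop
      (𝓝 0) := by
    have h1 : Tendsto (fun n : ℕ => 2 * (r : ℝ) / (2 * (n : ℝ) + 1)) atTop (𝓝 0) := by
      refine Tendsto.div_atTop tendsto_const_nhds ?_
      exact tendsto_atTop_add_const_right _ _
        (tendsto_natCast_atTop_atTop.const_mul_atTop (by norm_num : (0 : ℝ) < 2))
    have h2 := (((h1.const_add 1).pow d).sub_const 1).const_mul (2 * C)
    simpa using h2
  exact squeeze_zero_norm (fun n => by simpa [Real.norm_eq_abs] using key n) hlim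

lemma boxAverage_sum {ι : Type*} (s : Finset ι) (g : ι → (Fin d → ℤ) → ℝ) (n : ℕ) :
    boxAverage (fun v => ∑ i ∈ s, g i v) n = ∑ i ∈ s, boxAverage (g i) n := by
  unfold boxAverage
  rw [Finset.sum_comm, Finset.sum_div]

lemma boxAverage_const (c : ℝ) (n : ℕ) : boxAverage (fun _ : Fin d → ℤ => c) n = c := by
  unfold boxAverage
  have hpos : (0 : ℝ) < (2 * (n : ℝ) + 1) ^ d := by positivity
  rw [Finset.sum_const, nsmul_eq_mul, card_box, mul_div_cancel_left₀ _ hpos.ne']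

lemma boxAverage_mono {g h : (Fin d → ℤ) → ℝ} (H : ∀ v, g v ≤ h v) (n : ℕ) :
    boxAverage g n ≤ boxAverage h n := by
  unfold boxAverage
  exact div_le_div_of_nonneg_right (Finset.sum_le_sum fun v _ => H v) (by positivity)

lemma tendsto_boxAverage_sum_translate_sub {ι : Type*} (s : Finset ι) (w : ι → Fin d → ℤ)
    {g : (Fin d → ℤ) → ℝ} {C : ℝ} (hg : ∀ v, |g v| ≤ C) :
    Tendsto (fun n => boxAverage (fun v => ∑ i ∈ s, g (v + w i)) n - s.card * boxAverage g n)
      atTop (𝓝 0) := by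
  have h := tendsto_finsetSum s fun i _ => tendsto_boxAverage_translate_sub hg (w i)
  simp only [Finset.sum_sub_distrib, Finset.sum_const_zero, Finset.sum_const, nsmul_eq_mul] at h
  simpa only [boxAverage_sum] using h

/-- Averaging the window sums over `v` gives the window size times the density, so a uniform bound
on one finite window bounds the density. -/
lemma le_mul_of_tendsto_boxAverage {ι : Type*} (s : Finset ι) (w : ι → Fin d → ℤ)
    {g : (Fin d → ℤ) → ℝ} {C : ℝ} (hg : ∀ v, |g v| ≤ C) {a c : ℝ}
    (ha : Tendsto (boxAverage g) atTop (𝓝 a)) (hc : ∀ v, c ≤ ∑ i ∈ s, g (v + w i)) :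
    c ≤ s.card * a := by
  have h := (tendsto_boxAverage_sum_translate_sub s w hg).add (ha.const_mul (s.card : ℝ))
  simp only [sub_add_cancel, zero_add] at h
  refine ge_of_tendsto' h fun n => ?_
  rw [← boxAverage_const (d := d) c n]
  exact boxAverage_mono hc n

lemma tendsto_boxAverage_of_sum_eq {ι : Type*} (s : Finset ι) (hs : s.Nonempty)
    (w : ι → Fin d → ℤ) {g : (Fin d → ℤ) → ℝ} {C : ℝ} (hg : ∀ v, |g v| ≤ C) {c : ℝ}
    (hc : ∀ v, ∑ i ∈ s, g (v + w i) = c) :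
    Tendsto (boxAverage g) atTop (𝓝 (c / s.card)) := by
  have hs' : (s.card : ℝ) ≠ 0 := by exact_mod_cast hs.card_pos.ne'
  have h := (tendsto_boxAverage_sum_translate_sub s w hg).const_sub c |>.div_const (s.card : ℝ)
  simp only [hc, boxAverage_const, sub_sub_cancel, mul_div_cancel_left₀ _ hs', sub_zero] at h
  exact h

/-- The point of `ℤ^d` with coordinates in `[0, M)` representing a vector modulo `M`. -/
def residueVec (M : ℕ) (ω : Fin d → ZMod M) : Fin d → ℤ := fun j => ((ω j).val : ℤ)

/-- Translation by `v` permutes the residue classes modulo `M`. -/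
lemma sum_residueVec_translate {M : ℕ} [NeZero M] {E : Type*} [AddCommMonoid E]
    {g : (Fin d → ℤ) → E} (hg : ∀ v v' : Fin d → ℤ, (∀ j, (M : ℤ) ∣ v' j - v j) → g v = g v')
    (v : Fin d → ℤ) :
    ∑ ω : Fin d → ZMod M, g (v + residueVec M ω) = ∑ ω : Fin d → ZMod M, g (residueVec M ω) := by
  let c : Fin d → ZMod M := fun j => ((v j : ℤ) : ZMod M)
  refine Fintype.sum_equiv (Equiv.addLeft c) _ _ fun ω => hg _ _ fun j => ?_
  rw [← ZMod.intCast_zmod_eq_zero_iff_dvd]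
  simp [residueVec, c]

end Averages

/-! ### Cutting and pasting configurations along equal slabs. -/

section Gluing

variable {V A : Type*} [AddCommGroup V]

/-- A set of configurations is `K`-local along `φ` if it contains every configuration which around
each position looks, on the slab `|φ| ≤ K`, like a member of the set around some position. -/
def IsLocalAlong (φ : V →+ ℤ) (K : ℤ) (P : Set (V → A)) : Prop :=
  ∀ y : V → A, (∀ v, ∃ x ∈ P, ∃ v', ∀ w, |φ w| ≤ K → y (v + w) = x (v' + w)) → y ∈ P

variable {φ : V →+ ℤ} {K : ℤ} {P : Set (V → A)} {u : V}

lemma IsLocalAlong.shift_mem (hP : IsLocalAlong φ K P) {x : V → A} (hx : x ∈ P) (v : V) :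
    shift v x ∈ P :=
  hP _ fun v' => ⟨x, hx, v + v', fun w _ => by simp [add_assoc]⟩

/-- A configuration that looks the same on two slabs can be made periodic by repeating the part
between these slabs. -/
lemma IsLocalAlong.exists_periodic (hP : IsLocalAlong φ K P) (hu : 0 < φ u) {x : V → A}
    (hx : x ∈ P) {m : ℕ} (hm : 0 < m) (h : ∀ w, |φ w| ≤ K → x w = x (m • u + w)) :
    ∃ y ∈ P, (∀ v, y (m • u + v) = y v) ∧
      ∀ v, -K ≤ φ v → φ v ≤ m * φ u + K → y v = x v := by
  have hmp : 0 < (m : ℤ) * φ u := by positivity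
  have hφ : φ (m • u) = m * φ u := by simp
  set τ := m • u with hτ
  set p := (m : ℤ) * φ u with hp
  -- Each point is moved by a multiple of `τ` into the strip `0 ≤ φ < p`, where `x` is read.
  let y : V → A := fun v => x (v - (φ v / p) • τ)
  have hper1 : ∀ v, y (τ + v) = y v := by
    intro v
    have : (φ (τ + v)) / p = φ v / p + 1 := by
      rw [map_add, hφ, add_comm, Int.add_ediv_of_dvd_right (dvd_refl _), Int.ediv_self hmp.ne']
    simp only [y, this]
    congr 1
    rw [add_smul, one_smul]; abel
  -- Several translations may be needed because the slabs can be wider than the period `p`; each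
  -- intermediate point still lies in the slab where `h` applies.
  have hup : ∀ (n : ℕ) (r : V), 0 ≤ φ r → φ r + n * p ≤ p + K → x (r + n • τ) = x r := by
    intro n
    induction n with
    | zero => simp
    | succ n ih =>
      intro r hr hr'
      push_cast at hr'
      have hn : 0 ≤ (n : ℤ) * p := by positivity
      have h1 : x (r + n • τ) = x (τ + (r + n • τ)) := by
        apply h
        rw [map_add, map_nsmul, hφ, nsmul_eq_mul, abs_le]
        constructor <;> nlinarith
      rw [← ih r hr (by nlinarith), h1]
      congr 1
      rw [succ_nsmul]; abel
  have hdown : ∀ (n : ℕ) (r : V), φ r < p → -K ≤ φ r - n * p → x (r - n • τ) = x r := by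
    intro n
    induction n with
    | zero => simp
    | succ n ih =>
      intro r hr hr'
      push_cast at hr'
      have hn : 0 ≤ (n : ℤ) * p := by positivity
      have h1 : x (r - (n + 1) • τ) = x (τ + (r - (n + 1) • τ)) := by
        apply h
        rw [map_sub, map_nsmul, hφ, nsmul_eq_mul, abs_le]
        push_cast
        constructor <;> nlinarith
      rw [← ih r hr (by nlinarith), h1]
      congr 1
      rw [succ_nsmul]; abel
  have hagree : ∀ v, -K ≤ φ v → φ v ≤ p + K → y v = x v := by
    intro v h1 h2
    have hmod0 := Int.emod_nonneg (φ v) hmp.ne'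
    have hmod1 := Int.emod_lt_of_pos (φ v) hmp
    have hdiv := Int.emod_add_mul_ediv (φ v) p
    set c := φ v / p with hc
    set r := v - c • τ with hr
    have hφr : φ r = φ v % p := by
      rw [hr, map_sub, map_zsmul, hφ, smul_eq_mul]; linarith
    have hv : v = r + c • τ := by rw [hr]; abel
    change x r = x v
    rcases Int.eq_nat_or_neg c with ⟨n, hn | hn⟩
    · rw [hv, hn, natCast_zsmul]
      refine (hup n r (by omega) ?_).symm
      rw [hφr, ← hn]; linarith
    · rw [hv, hn, neg_smul, natCast_zsmul, ← sub_eq_add_neg]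
      refine (hdown n r (by omega) ?_).symm
      rw [hφr, show (n : ℤ) = -c by omega]; linarith
  refine ⟨y, hP _ fun v => ?_, hper1, hagree⟩
  -- After reduction to `0 ≤ φ < p`, the whole window of half-width `K` lies where `y` and `x`
  -- agree.
  refine ⟨x, hx, v - (φ v / p) • τ, fun w hw => ?_⟩
  have hmod0 := Int.emod_nonneg (φ v) hmp.ne'
  have hmod1 := Int.emod_lt_of_pos (φ v) hmp
  have hdiv := Int.emod_add_mul_ediv (φ v) p
  have hz : ∀ (c : ℤ) v, y (v - c • τ) = y v := by
    intro c v
    have : φ (v - c • τ) / p = φ v / p - c := by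
      rw [map_sub, map_zsmul, hφ, smul_eq_mul, Int.sub_mul_ediv_right _ _ hmp.ne']
    simp only [y, this]
    congr 1
    rw [sub_smul]; abel
  have hφ' : φ (v - (φ v / p) • τ + w) = φ v % p + φ w := by
    rw [map_add, map_sub, map_zsmul, hφ, smul_eq_mul]; linarith
  rw [abs_le] at hw
  rw [← hagree (v - (φ v / p) • τ + w) (by omega) (by omega), ← hz (φ v / p) (v + w)]
  congr 1; abel

/-- The part of a configuration between two equal slabs can be cut out. -/
lemma IsLocalAlong.exists_excision (hP : IsLocalAlong φ K P) {x : V → A}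
    (hx : x ∈ P) {a b : V} (h : ∀ w, |φ w| ≤ K → x (a + w) = x (b + w)) :
    ∃ z ∈ P, (∀ v, φ v ≤ φ a + K → z v = x v) ∧
      ∀ v, φ a - K ≤ φ v → z v = x (b - a + v) := by
  classical
  -- On the slab around `a` both formulas give the same value, so every window of half-width `K`
  -- sees only one of the two halves of `x`.
  let z : V → A := fun v => if φ v < φ a then x v else x (b - a + v)
  have h1 : ∀ v, φ v ≤ φ a + K → z v = x v := by
    intro v hv
    by_cases hc : φ v < φ a
    · simp [z, hc]
    · simp only [z, hc, if_false]
      have := h (v - a) (by rw [map_sub, abs_le]; omega)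
      rw [show a + (v - a) = v by abel] at this
      rw [this]; congr 1; abel
  have h2 : ∀ v, φ a - K ≤ φ v → z v = x (b - a + v) := by
    intro v hv
    by_cases hc : φ v < φ a
    · simp only [z, hc, if_true]
      have := h (v - a) (by rw [map_sub, abs_le]; omega)
      rw [show a + (v - a) = v by abel] at this
      rw [this]; congr 1; abel
    · simp [z, hc]
  refine ⟨z, hP _ fun v => ?_, h1, h2⟩
  by_cases hc : φ v < φ a
  · exact ⟨x, hx, v, fun w hw => h1 _ (by rw [map_add]; have := abs_le.1 hw; omega)⟩
  · refine ⟨x, hx, b - a + v, fun w hw => ?_⟩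
    rw [h2 _ (by rw [map_add]; have := abs_le.1 hw; omega), add_assoc]

/-- If the sums of a local observable along all cycles of bounded length are at least `q` times the
length of the cycle, then its sums along all orbit segments are at least `q` times the length of the
segment, up to a constant. -/
lemma IsLocalAlong.sum_ge (hP : IsLocalAlong φ K P) (hu : 0 < φ u) {B : ℕ}
    (hB : ∀ x ∈ P, ∃ s t : ℕ, s < t ∧ t ≤ B ∧ ∀ w, |φ w| ≤ K → x (s • u + w) = x (t • u + w))
    {G : (V → A) → ℝ} {C₀ q : ℝ} (hC₀ : ∀ x ∈ P, |G x| ≤ C₀)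
    (hG : ∀ x ∈ P, ∀ y ∈ P, (∀ w, |φ w| ≤ K → x w = y w) → G x = G y)
    (hq : ∀ y ∈ P, ∀ m : ℕ, 0 < m → m ≤ B → (∀ v, y (m • u + v) = y v) →
      m * q ≤ ∑ j ∈ Finset.range m, G (shift (j • u) y)) (n : ℕ) :
    ∀ x ∈ P, n * q - B * (C₀ + |q|) ≤ ∑ j ∈ Finset.range n, G (shift (j • u) x) := by
  induction n using Nat.strong_induction_on with
  | _ n ih =>
    intro x hx
    have hφ : ∀ j : ℕ, φ (j • u) = j * φ u := fun j => by simp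
    have hC₀' : 0 ≤ C₀ := (abs_nonneg _).trans (hC₀ x hx)
    -- For short segments the constant absorbs everything. For `n > B` a cycle lies inside the
    -- segment: `y` repeats it, `z` omits it, and the sum for `x` is the cycle sum for `y` plus a
    -- shorter orbit sum for `z`. The cycle costs no error, so the constant does not grow.
    rcases le_or_gt n B with hn | hn
    · have h1 : ∑ j ∈ Finset.range n, (-C₀) ≤ ∑ j ∈ Finset.range n, G (shift (j • u) x) :=
        Finset.sum_le_sum fun j _ => (abs_le.1 (hC₀ _ (hP.shift_mem hx _))).1
      have h2 : (n : ℝ) ≤ B := by exact_mod_cast hn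
      have h3 := le_abs_self q
      have h4 : (0 : ℝ) ≤ n := by positivity
      simp only [Finset.sum_const, Finset.card_range, nsmul_eq_mul] at h1
      nlinarith [mul_le_mul_of_nonneg_left h3 h4,
        mul_le_mul_of_nonneg_right h2 (add_nonneg hC₀' (abs_nonneg q))]
    · obtain ⟨s, t, hst, htB, hslab⟩ := hB x hx
      obtain ⟨m, rfl⟩ := Nat.exists_eq_add_of_lt hst
      set m' := m + 1 with hm'
      have htn : s + m' < n := by omega
      obtain ⟨r, rfl⟩ := Nat.exists_eq_add_of_lt htn
      have hx' := hP.shift_mem hx (s • u)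
      obtain ⟨y, hy, hyper, hyx⟩ := hP.exists_periodic hu hx' (m := m') (by omega) (by
        intro w hw
        have := hslab w hw
        simp only [shift_apply]
        rw [this]; congr 1
        rw [add_assoc s m 1, ← hm', add_smul]; abel)
      obtain ⟨z, hz, hz1, hz2⟩ := hP.exists_excision hx hslab
      have hcyc : ∑ j ∈ Finset.range m', G (shift (j • u) y) =
          ∑ j ∈ Finset.range m', G (shift ((s + j) • u) x) := by
        refine Finset.sum_congr rfl fun j hj => ?_
        refine hG _ (hP.shift_mem hy _) _ (hP.shift_mem hx _) fun w hw => ?_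
        have hj' : (j : ℤ) ≤ m' := by exact_mod_cast (Finset.mem_range.1 hj).le
        have hj0 : 0 ≤ (j : ℤ) * φ u := by positivity
        rw [abs_le] at hw
        simp only [shift_apply]
        rw [hyx _ (by rw [map_add, hφ]; linarith) (by rw [map_add, hφ]; nlinarith)]
        simp only [shift_apply]
        congr 1
        rw [add_smul]; abel
      have hz1' : ∑ j ∈ Finset.range s, G (shift (j • u) z) =
          ∑ j ∈ Finset.range s, G (shift (j • u) x) := by
        refine Finset.sum_congr rfl fun j hj => ?_
        refine hG _ (hP.shift_mem hz _) _ (hP.shift_mem hx _) fun w hw => ?_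
        have hj' : (j : ℤ) ≤ s := by exact_mod_cast (Finset.mem_range.1 hj).le
        rw [abs_le] at hw
        simp only [shift_apply]
        exact hz1 _ (by rw [map_add, hφ, hφ]; nlinarith)
      have hz2' : ∑ j ∈ Finset.range (r + 1), G (shift ((s + j) • u) z) =
          ∑ j ∈ Finset.range (r + 1), G (shift ((s + m' + j) • u) x) := by
        refine Finset.sum_congr rfl fun j hj => ?_
        refine hG _ (hP.shift_mem hz _) _ (hP.shift_mem hx _) fun w hw => ?_
        rw [abs_le] at hw
        have hj0 : 0 ≤ (j : ℤ) * φ u := by positivity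
        simp only [shift_apply]
        rw [hz2 _ (by rw [map_add, hφ, hφ]; push_cast; nlinarith)]
        congr 1
        rw [add_assoc s m 1, ← hm']
        simp only [add_smul]; abel
      have hih := ih (s + (r + 1)) (by omega) z hz
      have hq' := hq y hy m' (by omega) (by omega) hyper
      rw [Finset.sum_range_add, hz1', hz2'] at hih
      rw [hcyc] at hq'
      rw [show s + m' + r + 1 = s + (m' + (r + 1)) by ring, Finset.sum_range_add,
        Finset.sum_range_add]
      simp only [← add_assoc] at hih hq' ⊢
      push_cast at hih hq' ⊢
      linarith

end Gluing

/-! ### Linear algebra of subgroups of corank one, with explicit bounds. -/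

section Lattice

open Module Matrix

instance finite_addSubgroup {d : ℕ} (L : AddSubgroup (Fin d → ℤ)) : Module.Finite ℤ L :=
  inferInstanceAs (Module.Finite ℤ (AddSubgroup.toIntSubmodule L))

instance free_addSubgroup {d : ℕ} (L : AddSubgroup (Fin d → ℤ)) : Module.Free ℤ L :=
  inferInstanceAs (Module.Free ℤ (AddSubgroup.toIntSubmodule L))

/-- A set generating a subgroup of `ℤ^(c+1)` of rank `c` contains `c` vectors which together with a
vector of the standard basis form a nonsingular matrix. -/
lemma exists_cons_det_ne_zero {c : ℕ} {G : Set (Fin (c + 1) → ℤ)}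
    {L : AddSubgroup (Fin (c + 1) → ℤ)} (hL : finrank ℤ L = c) (hG : L = AddSubgroup.closure G) :
    ∃ (g : Fin c → Fin (c + 1) → ℤ) (k : Fin (c + 1)), (∀ i, g i ∈ G) ∧
      (Matrix.of (Fin.cons (Pi.single k 1) g : Fin (c + 1) → Fin (c + 1) → ℤ)).det ≠ 0 := by
  let ι : (Fin (c + 1) → ℤ) →ₗ[ℤ] (Fin (c + 1) → ℚ) :=
    (Algebra.linearMap ℤ ℚ).compLeft (Fin (c + 1))
  have hι : ∀ v j, ι v j = (v j : ℚ) := fun v j => rfl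
  have hker : LinearMap.ker ι = ⊥ := by
    rw [LinearMap.ker_eq_bot]
    intro v w h
    funext j
    have := congrFun h j
    rwa [hι, hι, Int.cast_inj] at this
  set W := Submodule.span ℚ (ι '' G) with hW
  have hLW : ∀ l ∈ L, ι l ∈ W := by
    have : L ≤ (W.toAddSubgroup.comap ι.toAddMonoidHom) := by
      rw [hG, AddSubgroup.closure_le]
      exact fun g hg => Submodule.subset_span ⟨g, hg, rfl⟩
    exact fun l hl => this hl
  have hc : c ≤ finrank ℚ W := by
    let b := finBasisOfFinrankEq ℤ L hL
    have h1 : LinearIndependent ℤ (fun i => (b i : Fin (c + 1) → ℤ)) :=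
      b.linearIndependent.map' L.subtype.toIntLinearMap
        (LinearMap.ker_eq_bot.2 Subtype.coe_injective)
    have h2 := (LinearIndependent.iff_fractionRing ℤ ℚ).1 (h1.map' ι hker)
    have h3 : LinearIndependent ℚ (fun i => (⟨ι (b i), hLW _ (b i).2⟩ : W)) :=
      LinearIndependent.of_comp W.subtype h2
    simpa using h3.fintype_card_le_finrank
  obtain ⟨f, hfs, -, hf⟩ := Submodule.exists_fun_fin_finrank_span_eq ℚ (ι '' G)
  have hf' : LinearIndependent ℚ (f ∘ Fin.castLE hc) := hf.comp _ (Fin.castLE_injective hc)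
  choose g hg hgf using fun i => hfs (Fin.castLE hc i)
  have hfg : f ∘ Fin.castLE hc = ι ∘ g := funext fun i => (hgf i).symm
  rw [hfg] at hf'
  -- The span of `c` vectors is a proper subspace of `ℚ^(c+1)`, so it misses some standard basis
  -- vector.
  obtain ⟨k, hk⟩ : ∃ k, ι (Pi.single k 1) ∉ Submodule.span ℚ (Set.range (ι ∘ g)) := by
    by_contra! h
    have htop : Submodule.span ℚ (Set.range (ι ∘ g)) = ⊤ := by
      rw [eq_top_iff, ← (Pi.basisFun ℚ (Fin (c + 1))).span_eq, Submodule.span_le]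
      rintro _ ⟨k, rfl⟩
      have hk : Pi.basisFun ℚ (Fin (c + 1)) k = ι (Pi.single k 1) := by
        rw [Pi.basisFun_apply]
        funext j
        rw [hι]
        by_cases hj : j = k
        · subst hj; simp
        · simp [hj]
      rw [hk]
      exact h k
    have h1 := finrank_span_eq_card hf'
    rw [htop, finrank_top] at h1
    simp at h1
  refine ⟨g, k, hg, fun hdet => ?_⟩
  have hrow : (Fin.cons (ι (Pi.single k 1)) (ι ∘ g) : Fin (c + 1) → Fin (c + 1) → ℚ) =
      ((Matrix.of (Fin.cons (Pi.single k 1) g : Fin (c + 1) → Fin (c + 1) → ℤ)).map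
        (Int.castRingHom ℚ)).row := by
    funext i
    refine Fin.cases ?_ (fun i => ?_) i <;> · funext j; simp [Matrix.row, hι]
  have hli := linearIndependent_finCons.2 ⟨hf', hk⟩
  have hu := Matrix.linearIndependent_rows_iff_isUnit.1 (hrow ▸ hli)
  rw [Matrix.isUnit_iff_isUnit_det, ← RingHom.mapMatrix_apply, ← RingHom.map_det, hdet] at hu
  simp at hu

lemma abs_det_le {n : ℕ} {N : Matrix (Fin n) (Fin n) ℤ} {R : ℕ} (hn : n ≤ R)
    (h : ∀ i j, |N i j| ≤ R) : |N.det| ≤ (R.factorial * R ^ R : ℕ) := by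
  have h1 := Matrix.det_le (A := N) (abv := AbsoluteValue.abs) (x := (R : ℤ)) h
  simp only [Fintype.card_fin, AbsoluteValue.abs_apply, nsmul_eq_mul] at h1
  refine h1.trans ?_
  have h2 : n.factorial * R ^ n ≤ R.factorial * R ^ R := by
    refine Nat.mul_le_mul (Nat.factorial_le hn) ?_
    rcases Nat.eq_zero_or_pos R with rfl | hR
    · simp [Nat.le_zero.1 hn]
    · exact Nat.pow_le_pow_right hR hn
  exact_mod_cast h2

/-- A subgroup of `ℤ^(c+1)` of rank `c` has a transversal vector `u` and a functional `φ`, with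
bounds in terms of a bound for generators. -/
lemma exists_transversal {c : ℕ} {G : Set (Fin (c + 1) → ℤ)} {L : AddSubgroup (Fin (c + 1) → ℤ)}
    (hL : finrank ℤ L = c) (hG : L = AddSubgroup.closure G) {R : ℕ} (hR : c + 1 ≤ R)
    (hGR : ∀ g ∈ G, ∀ j, |g j| ≤ R) :
    ∃ (u : Fin (c + 1) → ℤ) (φ : (Fin (c + 1) → ℤ) →+ ℤ) (Δ : ℕ), 0 < Δ ∧
      Δ ≤ R.factorial * R ^ R ∧ φ u = Δ ∧ (∀ l ∈ L, φ l = 0) ∧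
      (∀ v, ∀ S : ℕ, (∀ j, |v j| ≤ (S : ℤ)) → |φ v| ≤ (R * (R.factorial * R ^ R) * S : ℕ)) ∧
      (∀ v, ∃ a : ℤ, Δ • v - a • u ∈ L) ∧
      ∀ v, ∃ l ∈ L, ∀ j, |v j - l j| ≤ R * R + |φ v| := by
  obtain ⟨g, k, hg, hdet⟩ := exists_cons_det_ne_zero hL hG
  set u : Fin (c + 1) → ℤ := Pi.single k 1 with hu
  set N := Matrix.of (Fin.cons u g : Fin (c + 1) → Fin (c + 1) → ℤ) with hN
  have hgL : ∀ i, g i ∈ L := fun i => hG ▸ AddSubgroup.subset_closure (hg i)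
  have huj : ∀ j, |u j| ≤ 1 := by
    intro j
    by_cases hj : j = k
    · subst hj; simp [hu]
    · simp [hu, hj]
  have hR1 : (1 : ℤ) ≤ R := by exact_mod_cast (by omega : 1 ≤ R)
  have hNR : ∀ i j, |N i j| ≤ R := by
    intro i j
    refine Fin.cases ?_ (fun i => ?_) i
    · simpa [hN] using (huj j).trans hR1
    · simpa [hN] using hGR _ (hg i) j
  let c₀ : (Fin (c + 1) → ℤ) →+ (Fin (c + 1) → ℤ) :=
    { toFun := fun v => v ᵥ* N.adjugate
      map_zero' := Matrix.zero_vecMul _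
      map_add' := Matrix.add_vecMul _ }
  -- By Cramer's rule this is the coefficient of `u` when `N.det • v` is expanded in the rows of
  -- `N`.
  let φ₀ : (Fin (c + 1) → ℤ) →+ ℤ := (Pi.evalAddMonoidHom _ 0).comp c₀
  have hφ₀ : ∀ v, φ₀ v = (v ᵥ* N.adjugate) 0 := fun v => rfl
  have hcramer : ∀ v, N.det • v = φ₀ v • u + ∑ i, (v ᵥ* N.adjugate) i.succ • g i := by
    intro v
    have h1 : (v ᵥ* N.adjugate) ᵥ* N = N.det • v := by
      rw [Matrix.vecMul_vecMul, Matrix.adjugate_mul, Matrix.vecMul_smul, Matrix.vecMul_one]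
    rw [← h1, Matrix.vecMul_eq_sum, Fin.sum_univ_succ]
    rfl
  have hφu : φ₀ u = N.det := by
    have h1 : u = Pi.single 0 1 ᵥ* N := by
      rw [Matrix.single_one_vecMul]; rfl
    rw [hφ₀, h1, Matrix.vecMul_vecMul, Matrix.mul_adjugate, Matrix.vecMul_smul, Matrix.vecMul_one]
    simp
  -- `φ₀ l` is the determinant of `N` with row `u` replaced by `l`. If it were nonzero, `l` and the
  -- `g i` would be `c + 1` independent vectors in a group of rank `c`.
  have hφL : ∀ l ∈ L, φ₀ l = 0 := by
    intro l hl
    by_contra hne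
    have h1 : N.updateRow 0 l = Matrix.of (Fin.cons l g : Fin (c + 1) → Fin (c + 1) → ℤ) := by
      ext i j
      refine Fin.cases ?_ (fun i => ?_) i
      · simp
      · rw [Matrix.updateRow_ne (Fin.succ_ne_zero i)]; rfl
    have h2 : φ₀ l = (N.updateRow 0 l).det := by
      rw [hφ₀, ← Matrix.cramer_transpose_apply, Matrix.cramer_eq_adjugate_mulVec,
        ← Matrix.adjugate_transpose, Matrix.mulVec_transpose]
    rw [h2] at hne
    have h3 := Matrix.linearIndependent_rows_of_det_ne_zero hne
    rw [h1] at h3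
    have hmem : ∀ i, (Fin.cons l g : Fin (c + 1) → Fin (c + 1) → ℤ) i ∈ L :=
      fun i => Fin.cases hl hgL i
    have h4 : LinearIndependent ℤ (fun i => (⟨_, hmem i⟩ : L)) :=
      LinearIndependent.of_comp L.subtype.toIntLinearMap h3
    have h5 := h4.fintype_card_le_finrank
    rw [hL] at h5
    simp at h5
  have hφb : ∀ v, ∀ S : ℕ, (∀ j, |v j| ≤ (S : ℤ)) →
      |φ₀ v| ≤ (R * (R.factorial * R ^ R) * S : ℕ) := by
    intro v S hS
    have hadj : ∀ i j, |N.adjugate i j| ≤ (R.factorial * R ^ R : ℕ) := by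
      intro i j
      rw [Matrix.adjugate_apply]
      refine abs_det_le hR fun a b => ?_
      by_cases ha : a = j
      · subst ha
        rw [Matrix.updateRow_self]
        refine le_trans ?_ hR1
        by_cases hb : b = i
        · subst hb; simp
        · simp [hb]
      · rw [Matrix.updateRow_ne ha]; exact hNR a b
    have h1 : φ₀ v = ∑ j, v j * N.adjugate j 0 := rfl
    rw [h1]
    calc |∑ j, v j * N.adjugate j 0| ≤ ∑ j, |v j * N.adjugate j 0| := Finset.abs_sum_le_sum_abs _ _
      _ ≤ ∑ j : Fin (c + 1), (S : ℤ) * (R.factorial * R ^ R : ℕ) := by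
          refine Finset.sum_le_sum fun j _ => ?_
          rw [abs_mul]
          exact mul_le_mul (hS j) (hadj j 0) (abs_nonneg _) (by positivity)
      _ = ((c + 1) * (R.factorial * R ^ R) * S : ℕ) := by simp; ring
      _ ≤ (R * (R.factorial * R ^ R) * S : ℕ) := by
          exact_mod_cast Nat.mul_le_mul_right _ (Nat.mul_le_mul_right _ hR)
  have hcombo : ∀ a : Fin c → ℤ, ∑ i, a i • g i ∈ L := fun a =>
    L.sum_mem fun i _ => L.zsmul_mem (hgL i) _
  have hΔpos : 0 < N.det.natAbs := Int.natAbs_pos.2 hdet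
  have hsign : N.det.sign * N.det = N.det.natAbs := Int.sign_mul_self_eq_natAbs _
  have hsabs : |N.det.sign| = 1 := by
    rcases lt_or_gt_of_ne hdet with h | h
    · simp [Int.sign_eq_neg_one_of_neg h]
    · simp [Int.sign_eq_one_of_pos h]
  -- The sign turns `φ₀ u = N.det` into the positive number `Δ = |N.det|`.
  refine ⟨u, N.det.sign • φ₀, N.det.natAbs, hΔpos, ?_, ?_, ?_, ?_, ?_, ?_⟩
  · have := abs_det_le hR hNR
    rw [Int.abs_eq_natAbs] at this
    exact_mod_cast this
  · rw [AddMonoidHom.smul_apply, hφu, smul_eq_mul, hsign]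
  · intro l hl
    rw [AddMonoidHom.smul_apply, hφL l hl, smul_zero]
  · intro v S hS
    rw [AddMonoidHom.smul_apply, smul_eq_mul, abs_mul, hsabs, one_mul]
    exact hφb v S hS
  · intro v
    refine ⟨N.det.sign * φ₀ v, ?_⟩
    have h1 : N.det.natAbs • v - (N.det.sign * φ₀ v) • u =
        N.det.sign • ∑ i, (v ᵥ* N.adjugate) i.succ • g i := by
      rw [← natCast_zsmul, ← hsign, mul_smul, hcramer, mul_smul, ← smul_sub, add_sub_cancel_left]
    rw [h1]
    exact L.zsmul_mem (hcombo _) _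
  · intro v
    set a := v ᵥ* N.adjugate with ha
    -- Integer division of the Cramer coefficients leaves remainders below `|N.det|`. After division
    -- by the determinant the `g i` contribute at most `c * R ≤ R * R`, and `u` at most `|φ v|`.
    refine ⟨∑ i, (a i.succ / N.det) • g i, hcombo _, fun j => ?_⟩
    have h1 : N.det * (v j - (∑ i, (a i.succ / N.det) • g i) j) =
        φ₀ v * u j + ∑ i, (a i.succ % N.det) * g i j := by
      have h2 := congrFun (hcramer v) j
      simp only [Pi.smul_apply, Pi.add_apply, smul_eq_mul, Finset.sum_apply] at h2 ⊢
      rw [mul_sub, h2, add_sub_assoc, Finset.mul_sum, ← Finset.sum_sub_distrib]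
      congr 1
      refine Finset.sum_congr rfl fun i _ => ?_
      have := Int.emod_add_mul_ediv (a i.succ) N.det
      rw [← ha]
      linear_combination (-g i j) * this
    have h2 : |N.det| * |v j - (∑ i, (a i.succ / N.det) • g i) j| ≤
        |N.det| * (R * R + |φ₀ v|) := by
      rw [← abs_mul, h1]
      have hΔ1 : (1 : ℤ) ≤ |N.det| := Int.one_le_abs hdet
      have h3 : |φ₀ v * u j| ≤ |N.det| * |φ₀ v| := by
        rw [abs_mul]
        nlinarith [abs_nonneg (φ₀ v), huj j]
      have h4 : |∑ i, (a i.succ % N.det) * g i j| ≤ |N.det| * (R * R) := by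
        calc |∑ i, (a i.succ % N.det) * g i j| ≤ ∑ i, |(a i.succ % N.det) * g i j| :=
              Finset.abs_sum_le_sum_abs _ _
          _ ≤ ∑ i : Fin c, |N.det| * R := by
              refine Finset.sum_le_sum fun i _ => ?_
              rw [abs_mul]
              refine mul_le_mul ?_ (hGR _ (hg i) j) (abs_nonneg _) (abs_nonneg _)
              rw [abs_of_nonneg (Int.emod_nonneg _ hdet)]
              exact (Int.emod_lt_abs _ hdet).le
          _ = |N.det| * (c * R) := by simp; ring
          _ ≤ |N.det| * (R * R) := by
              refine mul_le_mul_of_nonneg_left ?_ (abs_nonneg _)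
              exact mul_le_mul_of_nonneg_right (by exact_mod_cast (by omega : c ≤ R)) (by positivity)
      calc _ ≤ _ := abs_add_le _ _
        _ ≤ |N.det| * |φ₀ v| + |N.det| * (R * R) := add_le_add h3 h4
        _ = _ := by ring
    have h3 := le_of_mul_le_mul_left h2 (abs_pos.2 hdet)
    rwa [AddMonoidHom.smul_apply, smul_eq_mul, abs_mul, hsabs, one_mul]

end Lattice

/-! ### From periods in `L` and along `u` to periods in all coordinate directions. -/

section Periods

variable {V E : Type*} [AddCommGroup V]

/-- The group of periods of a function. -/
def periods (y : V → E) : AddSubgroup V where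
  carrier := {v | ∀ w, y (v + w) = y w}
  zero_mem' := fun w => by rw [zero_add]
  add_mem' := fun {a b} ha hb w => by rw [add_assoc, ha, hb]
  neg_mem' := fun {a} ha w => by rw [← ha (-a + w), add_neg_cancel_left]

/-- `y` is periodic with period `M` in each coordinate direction. -/
def IsPeriodicMod {d : ℕ} (M : ℕ) (y : (Fin d → ℤ) → E) : Prop :=
  ∀ v v' : Fin d → ℤ, (∀ j, (M : ℤ) ∣ v' j - v j) → y v = y v'

/-- If `D • v` lies in `L + ℤ u`, then `(D * m) • v` lies in `L + ℤ (m • u)`, which consists of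
periods. -/
lemma isPeriodicMod_of_periods {d : ℕ} {y : (Fin d → ℤ) → E} {L : AddSubgroup (Fin d → ℤ)}
    {u : Fin d → ℤ} {D m M : ℕ} (hD : ∀ v, ∃ a : ℤ, D • v - a • u ∈ L) (hL : L ≤ periods y)
    (hu : m • u ∈ periods y) (hM : D * m ∣ M) : IsPeriodicMod M y := by
  intro v v' h
  choose t ht using h
  obtain ⟨k, rfl⟩ := hM
  obtain ⟨a, ha⟩ := hD (k • t)
  have h1 : m • (D • k • t - a • u) + a • m • u ∈ periods y :=
    add_mem (nsmul_mem (hL ha) m) (zsmul_mem hu a)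
  have h2 : v' = m • (D • k • t - a • u) + a • m • u + v := by
    have h3 : m • (D • k • t - a • u) + a • m • u = (D * m * k) • t := by
      rw [smul_sub, smul_comm a m u, sub_add_cancel, smul_smul, smul_smul]
      congr 1; ring
    rw [h3]
    funext j
    have := ht j
    rw [Pi.add_apply, Pi.smul_apply, nsmul_eq_mul]
    push_cast at this ⊢
    linarith
  rw [h2, h1 v]

end Periods

/-! ### Explicit bounds in terms of a single size parameter. -/

section Bounds

/-- A bound for the determinants of matrices of size at most `R` with entries at most `R`. -/
def detBound (R : ℕ) : ℕ := R.factorial * R ^ R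

/-- A common multiple of the numbers up to `detBound R`. -/
def modulus (R : ℕ) : ℕ := (detBound R).factorial

/-- The half-width of the slabs separating the past from the future. -/
def slabWidth (R : ℕ) : ℕ := R * detBound R * (modulus R + R)

/-- The radius of a box containing representatives of the points of a slab. -/
def boxRadius (R : ℕ) : ℕ := R * R + slabWidth R

/-- A bound for the number of restrictions of configurations to a slab. -/
def stateBound (R : ℕ) : ℕ := R ^ (2 * boxRadius R + 1) ^ R

/-- A common period for a set of periodic configurations realizing the minimum density. -/
def commonPeriod (R : ℕ) : ℕ := modulus R * (stateBound R).factorial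

lemma commonPeriod_pos (R : ℕ) : 0 < commonPeriod R :=
  Nat.mul_pos (Nat.factorial_pos _) (Nat.factorial_pos _)

end Bounds

/-! ### Densities of periodic configurations as finite averages. -/

lemma tendsto_boxAverage_of_isPeriodicMod {d M : ℕ} [NeZero M] {g : (Fin d → ℤ) → ℝ} {C : ℝ}
    (hC : ∀ v, |g v| ≤ C) (hg : IsPeriodicMod M g) :
    Tendsto (boxAverage g) atTop
      (𝓝 ((∑ ω : Fin d → ZMod M, g (residueVec M ω)) / (M : ℝ) ^ d)) := by
  have h := tendsto_boxAverage_of_sum_eq (Finset.univ : Finset (Fin d → ZMod M))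
    Finset.univ_nonempty (residueVec M) hC (sum_residueVec_translate hg)
  simpa [ZMod.card] using h

/-- Identifies the mean of a cycle with a density. Translates by `L` and `u` alone need not reach
all of `ℤ^d`; summing also over a box of side `D` repairs this, since `D • v` always lies in `L + ℤ
u`. -/
lemma sum_cycle_eq {d : ℕ} {g : (Fin d → ℤ) → ℝ} {C : ℝ} (hC : ∀ v, |g v| ≤ C)
    {L : AddSubgroup (Fin d → ℤ)} {u : Fin d → ℤ} {D m M : ℕ} [NeZero D] [NeZero M] (hm : 0 < m)
    (hD : ∀ v, ∃ a : ℤ, D • v - a • u ∈ L) (hL : L ≤ periods g) (hu : m • u ∈ periods g)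
    (hM : D * m ∣ M) :
    ∑ j ∈ Finset.range m, ∑ ω : Fin d → ZMod D, g (j • u + residueVec D ω) =
      m * ((D : ℝ) ^ d * ((∑ ω : Fin d → ZMod M, g (residueVec M ω)) / (M : ℝ) ^ d)) := by
  set c := ∑ j ∈ Finset.range m, ∑ ω : Fin d → ZMod D, g (j • u + residueVec D ω) with hc
  -- Summing over a full cycle makes `u` itself a period, so `H` is periodic modulo `D` and its sum
  -- over a box of side `D` does not depend on the position of the box.
  let H : (Fin d → ℤ) → ℝ := fun v => ∑ j ∈ Finset.range m, g (v + j • u)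
  have hHL : L ≤ periods H := by
    intro l hl v
    refine Finset.sum_congr rfl fun j _ => ?_
    rw [add_assoc, hL hl]
  have hHu : 1 • u ∈ periods H := by
    intro v
    have h1 := Finset.sum_range_succ (fun j => g (v + j • u)) m
    have h2 := Finset.sum_range_succ' (fun j => g (v + j • u)) m
    have h3 : g (v + m • u) = g (v + 0 • u) := by rw [zero_smul, add_zero, add_comm, hu]
    rw [h1, h3, add_left_inj] at h2
    refine Eq.trans (Finset.sum_congr rfl fun j _ => ?_) h2.symm
    congr 1
    rw [add_smul, one_smul]; abel
  have hHper : IsPeriodicMod D H := isPeriodicMod_of_periods hD hHL hHu (by simp)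
  have hsum : ∀ v, ∑ i ∈ Finset.range m ×ˢ (Finset.univ : Finset (Fin d → ZMod D)),
      g (v + (i.1 • u + residueVec D i.2)) = c := by
    have h1 : ∀ v, ∑ i ∈ Finset.range m ×ˢ (Finset.univ : Finset (Fin d → ZMod D)),
        g (v + (i.1 • u + residueVec D i.2)) = ∑ ω, H (v + residueVec D ω) := by
      intro v
      rw [Finset.sum_product_right]
      refine Finset.sum_congr rfl fun ω _ => Finset.sum_congr rfl fun j _ => ?_
      congr 1; abel
    intro v
    rw [h1, sum_residueVec_translate hHper, hc, Finset.sum_comm]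
    refine Finset.sum_congr rfl fun ω _ => Finset.sum_congr rfl fun j _ => ?_
    rw [add_comm]
  have h1 := tendsto_boxAverage_of_sum_eq
    (Finset.range m ×ˢ (Finset.univ : Finset (Fin d → ZMod D)))
    ((Finset.nonempty_range_iff.2 hm.ne').product Finset.univ_nonempty)
    (fun i => i.1 • u + residueVec D i.2) hC hsum
  have h2 := tendsto_boxAverage_of_isPeriodicMod (M := M) hC (isPeriodicMod_of_periods hD hL hu hM)
  have h3 := tendsto_nhds_unique h1 h2
  rw [← h3]
  have hD0 : (D : ℝ) ≠ 0 := by exact_mod_cast NeZero.ne D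
  have hm0 : (m : ℝ) ≠ 0 := by exact_mod_cast hm.ne'
  simp only [Finset.card_product, Finset.card_range, Finset.card_univ, Fintype.card_pi,
    ZMod.card, Finset.prod_const, Fintype.card_fin, Nat.cast_mul, Nat.cast_pow]
  field_simp

/-! ### Reduction of the minimum to configurations with a common period. -/

section Density

variable {c : ℕ} {A : Type*}

lemma periods_le_periods_shift {d : ℕ} (x : (Fin d → ℤ) → A) {E : Type*}
    (G : ((Fin d → ℤ) → A) → E) :
    periods x ≤ periods (fun v => G (shift v x)) := by
  intro l hl v
  refine congrArg G (funext fun w => ?_)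
  rw [shift_apply, shift_apply, add_assoc, hl]

lemma IsPeriodicMod.shift {d M : ℕ} {x : (Fin d → ℤ) → A} (hx : IsPeriodicMod M x) {E : Type*}
    (G : ((Fin d → ℤ) → A) → E) : IsPeriodicMod M (fun v => G (shift v x)) := by
  intro v v' h
  refine congrArg G (funext fun w => hx _ _ fun j => ?_)
  simpa using h j

/-- Pigeonhole on the translates by `0, u, …, B • u`: an `L`-periodic configuration is determined on
a slab by its values on a box of radius `r`. -/
lemma exists_equal_slabs [Finite A] {L : AddSubgroup (Fin (c + 1) → ℤ)}
    {φ : (Fin (c + 1) → ℤ) →+ ℤ} {K r B : ℕ} (u : Fin (c + 1) → ℤ)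
    (hr : ∀ v, |φ v| ≤ K → ∃ l ∈ L, ∀ j, |v j - l j| ≤ (r : ℤ))
    (hB : Nat.card A ^ (2 * r + 1) ^ (c + 1) ≤ B) {x : (Fin (c + 1) → ℤ) → A}
    (hx : L ≤ periods x) :
    ∃ s t : ℕ, s < t ∧ t ≤ B ∧ ∀ w, |φ w| ≤ K → x (s • u + w) = x (t • u + w) := by
  classical
  have : Fintype A := Fintype.ofFinite A
  let S := Finset.Icc (fun _ : Fin (c + 1) => -(r : ℤ)) (fun _ : Fin (c + 1) => (r : ℤ))
  have hS : S.card = (2 * r + 1) ^ (c + 1) := by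
    have := card_box (c + 1) r
    exact_mod_cast this
  let state : Fin (B + 1) → (S → A) := fun n b => x ((n : ℕ) • u + b)
  have hcard : Fintype.card (S → A) < Fintype.card (Fin (B + 1)) := by
    rw [Fintype.card_fun, Fintype.card_coe, hS, Fintype.card_fin, ← Nat.card_eq_fintype_card]
    omega
  obtain ⟨s, t, hst, heq⟩ := Fintype.exists_ne_map_eq_of_card_lt state hcard
  have key : ∀ w, |φ w| ≤ K → x ((s : ℕ) • u + w) = x ((t : ℕ) • u + w) := by
    intro w hw
    obtain ⟨l, hl, hj⟩ := hr w hw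
    have hmem : w - l ∈ S := by
      simp only [S, Finset.mem_Icc, Pi.le_def, Pi.sub_apply]
      exact ⟨fun j => (abs_le.1 (hj j)).1, fun j => (abs_le.1 (hj j)).2⟩
    have h1 := congrFun heq ⟨w - l, hmem⟩
    have h2 : ∀ v, x (v + w) = x (v + (w - l)) := by
      intro v
      rw [← hx hl (v + (w - l))]
      congr 1; abel
    rw [h2, h2]
    exact h1
  rcases lt_or_gt_of_ne (Fin.val_ne_of_ne hst) with h | h
  · exact ⟨s, t, h, Nat.lt_succ_iff.1 t.2, key⟩
  · exact ⟨t, s, h, Nat.lt_succ_iff.1 s.2, fun w hw => (key w hw).symm⟩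

variable [TopologicalSpace A]

/-- A function on a subshift, as a real function on the full shift, extended by zero. -/
noncomputable def extendZero {d : ℕ} (Y : Subshift A (Fin d → ℤ)) (f : Y.carrier → ℚ)
    (x : (Fin d → ℤ) → A) : ℝ :=
  open Classical in if h : x ∈ Y.carrier then ((f ⟨x, h⟩ : ℚ) : ℝ) else 0

lemma extendZero_of_mem {d : ℕ} {Y : Subshift A (Fin d → ℤ)} {f : Y.carrier → ℚ}
    {x : (Fin d → ℤ) → A} (h : x ∈ Y.carrier) : extendZero Y f x = ((f ⟨x, h⟩ : ℚ) : ℝ) := by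
  simp [extendZero, h]

lemma le_periods_of_mem [T2Space A] {d : ℕ} {Y : Subshift A (Fin d → ℤ)}
    {L : AddSubgroup (Fin d → ℤ)} {x : (Fin d → ℤ) → A} (hx : x ∈ (periodicPart Y L).carrier) :
    L ≤ periods x :=
  fun l hl w => (congrFun (hx.2 l hl) w).symm

lemma hasDensity_iff [T2Space A] {d : ℕ} {Y : Subshift A (Fin d → ℤ)} {f : Y.carrier → ℚ}
    {L : AddSubgroup (Fin d → ℤ)} (x : (periodicPart Y L).carrier) (a : ℝ) :
    HasDensity (periodicPart Y L) (restrictPeriodic Y L f) x a ↔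
      Tendsto (boxAverage fun v => extendZero Y f (shift v x.1)) atTop (𝓝 a) := by
  have h : ∀ v, restrictPeriodic Y L f (shiftOn (periodicPart Y L) v x) =
      extendZero Y f (shift v x.1) := fun v =>
    (extendZero_of_mem (Y.mapsTo v x.2.1)).symm
  unfold HasDensity
  simp only [h]
  rfl

/-- The value of the density on configurations with period `M` in all directions. -/
noncomputable def periodicAverage {d : ℕ} (Y : Subshift A (Fin d → ℤ)) (f : Y.carrier → ℚ) (M : ℕ)
    [NeZero M] (x : (Fin d → ℤ) → A) : ℝ :=
  (∑ ω : Fin d → ZMod M, extendZero Y f (shift (residueVec M ω) x)) / (M : ℝ) ^ d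

variable [Inhabited A]

/-- The written data `F`, `T` for the subshift `Y` and the function `f` on it, with all positions
bounded by `R`. -/
structure IsPresentation {d : ℕ} (Y : Subshift A (Fin d → ℤ)) (f : Y.carrier → ℚ)
    (F : List (Pattern A (Fin d → ℤ))) (T : List (Pattern A (Fin d → ℤ) × ℚ)) (R : ℕ) : Prop where
  carrier_eq : Y.carrier = forbidden {P | P ∈ F}
  cover : ∀ x : Y.carrier, ∃ t ∈ T, t.1.occursInAt x.1 0
  value : ∀ x : Y.carrier, ∀ t ∈ T, t.1.occursInAt x.1 0 → f x = t.2
  bound_forbidden : ∀ P ∈ F, ∀ v ∈ P.support, ∀ j, |v j| ≤ (R : ℤ)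
  bound_table : ∀ t ∈ T, ∀ v ∈ t.1.support, ∀ j, |v j| ≤ (R : ℤ)

namespace IsPresentation

variable {d : ℕ} {Y : Subshift A (Fin d → ℤ)} {f : Y.carrier → ℚ}
  {F : List (Pattern A (Fin d → ℤ))} {T : List (Pattern A (Fin d → ℤ) × ℚ)} {R : ℕ}

lemma exists_bound (h : IsPresentation Y f F T R) : ∃ C : ℝ, ∀ x, |extendZero Y f x| ≤ C := by
  refine ⟨(T.map fun t => |(t.2 : ℝ)|).sum, fun x => ?_⟩
  have hnn : ∀ r ∈ T.map (fun t => |(t.2 : ℝ)|), 0 ≤ r := by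
    intro r hr
    obtain ⟨t, -, rfl⟩ := List.mem_map.1 hr
    positivity
  by_cases hx : x ∈ Y.carrier
  · obtain ⟨t, ht, hocc⟩ := h.cover ⟨x, hx⟩
    rw [extendZero_of_mem hx, h.value _ t ht hocc]
    exact List.single_le_sum hnn _ (List.mem_map_of_mem ht)
  · simp only [extendZero, hx, dif_neg, not_false_eq_true, abs_zero]
    exact List.sum_nonneg hnn

lemma extendZero_congr (h : IsPresentation Y f F T R) {x y : (Fin d → ℤ) → A}
    (hx : x ∈ Y.carrier) (hy : y ∈ Y.carrier)
    (hxy : ∀ w : Fin d → ℤ, (∀ j, |w j| ≤ (R : ℤ)) → x w = y w) :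
    extendZero Y f x = extendZero Y f y := by
  obtain ⟨t, ht, hocc⟩ := h.cover ⟨x, hx⟩
  have hocc' : t.1.occursInAt y 0 := by
    intro w hw
    rw [← hocc w hw, zero_add]
    exact (hxy w (h.bound_table t ht w hw)).symm
  rw [extendZero_of_mem hx, extendZero_of_mem hy, h.value _ t ht hocc,
    h.value ⟨y, hy⟩ t ht hocc']

/-- Forbidden patterns fit into a slab by the choice of `K`. The periods are visible too, because
`L` lies in the kernel of `φ`, hence in the slab. -/
lemma isLocalAlong [T2Space A] (h : IsPresentation Y f F T R) {L : AddSubgroup (Fin d → ℤ)}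
    {φ : (Fin d → ℤ) →+ ℤ} {K : ℤ} (hK : 0 ≤ K) (hφL : ∀ l ∈ L, φ l = 0)
    (hφ : ∀ v : Fin d → ℤ, (∀ j, |v j| ≤ (R : ℤ)) → |φ v| ≤ K) :
    IsLocalAlong φ K (periodicPart Y L).carrier := by
  intro y hy
  refine ⟨?_, fun l hl => ?_⟩
  · rw [h.carrier_eq]
    intro p hp g hocc
    obtain ⟨x, hx, v', hv'⟩ := hy g
    have hxY := hx.1
    rw [h.carrier_eq] at hxY
    refine hxY p hp v' fun w hw => ?_
    rw [← hv' w (hφ w (h.bound_forbidden p hp w hw))]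
    exact hocc w hw
  · funext v
    obtain ⟨x, hx, v', hv'⟩ := hy v
    have h1 := hv' 0 (by simpa using hK)
    have h2 := hv' l (by simpa [hφL l hl] using hK)
    have h3 := congrFun (hx.2 l hl) v'
    rw [add_zero, add_zero] at h1
    rw [shift_apply] at h3 ⊢
    rw [h1, h3, add_comm l v, h2, add_comm]

end IsPresentation

/-- Among the `L`-periodic configurations, those with period `commonPeriod R` in all directions
realize the minimum of the density. -/
theorem commonPeriod_spec [Finite A] [DiscreteTopology A] {Y : Subshift A (Fin (c + 1) → ℤ)}
    {f : Y.carrier → ℚ} {F : List (Pattern A (Fin (c + 1) → ℤ))}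
    {T : List (Pattern A (Fin (c + 1) → ℤ) × ℚ)} {R : ℕ} (hP : IsPresentation Y f F T R)
    {L : AddSubgroup (Fin (c + 1) → ℤ)} (hL : Module.finrank ℤ L = c)
    {G : Set (Fin (c + 1) → ℤ)} (hG : L = AddSubgroup.closure G)
    (hGR : ∀ g ∈ G, ∀ j, |g j| ≤ (R : ℤ)) (hR : c + 1 ≤ R) (hA : Nat.card A ≤ R)
    (hne : (periodicPart Y L).carrier.Nonempty) [NeZero (commonPeriod R)] :
    (∃ x ∈ (periodicPart Y L).carrier, IsPeriodicMod (commonPeriod R) x) ∧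
    ∀ q : ℝ, (∀ x ∈ (periodicPart Y L).carrier, IsPeriodicMod (commonPeriod R) x →
        q ≤ periodicAverage Y f (commonPeriod R) x) →
      ∀ (x : (periodicPart Y L).carrier) (a : ℝ),
        HasDensity (periodicPart Y L) (restrictPeriodic Y L f) x a → q ≤ a := by
  obtain ⟨u, φ, Δ, hΔ, hΔb, hφu, hφL, hφb, hΔL, hbox⟩ := exists_transversal hL hG hR hGR
  have hR0 : 0 < R := by omega
  set D := modulus R with hDdef
  have : NeZero D := ⟨(Nat.factorial_pos _).ne'⟩
  have hΔD : Δ ∣ D := Nat.dvd_factorial hΔ hΔb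
  have hD : ∀ v, ∃ a : ℤ, D • v - a • u ∈ L := by
    intro v
    obtain ⟨k, hk⟩ := hΔD
    obtain ⟨a, ha⟩ := hΔL (k • v)
    refine ⟨a, ?_⟩
    rwa [hk, mul_smul]
  have hu : 0 < φ u := by rw [hφu]; exact_mod_cast hΔ
  set K := slabWidth R with hK
  -- The width must cover the radius `R` seen by patterns and by `f`, enlarged by the box of side
  -- `D` over which `Φ` sums; this is the factor `modulus R + R` in `slabWidth`.
  have hφK : ∀ v : Fin (c + 1) → ℤ, (∀ j, |v j| ≤ (D : ℤ) + R) → |φ v| ≤ (K : ℤ) := by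
    intro v hv
    exact hφb v (D + R) (by exact_mod_cast hv)
  have hlocal : IsLocalAlong φ K (periodicPart Y L).carrier :=
    hP.isLocalAlong (by positivity) hφL fun v hv =>
      hφK v fun j => (hv j).trans (by simp)
  have hB : ∀ x ∈ (periodicPart Y L).carrier, ∃ s t : ℕ, s < t ∧ t ≤ stateBound R ∧
      ∀ w, |φ w| ≤ (K : ℤ) → x (s • u + w) = x (t • u + w) := by
    intro x hx
    refine exists_equal_slabs (L := L) (r := boxRadius R) u ?_ ?_ (le_periods_of_mem hx)
    · intro v hv
      obtain ⟨l, hl, hj⟩ := hbox v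
      refine ⟨l, hl, fun j => (hj j).trans ?_⟩
      rw [boxRadius, ← hK]
      push_cast
      linarith
    · calc Nat.card A ^ (2 * boxRadius R + 1) ^ (c + 1)
          ≤ R ^ (2 * boxRadius R + 1) ^ (c + 1) := Nat.pow_le_pow_left hA _
        _ ≤ R ^ (2 * boxRadius R + 1) ^ R :=
          Nat.pow_le_pow_right hR0 (Nat.pow_le_pow_right (by omega) hR)
  -- The factorials in `commonPeriod` make it a multiple of the period of every short cycle at once,
  -- whatever `u` and `Δ` are.
  have hdvd : ∀ m : ℕ, 0 < m → m ≤ stateBound R → D * m ∣ commonPeriod R := fun m h1 h2 =>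
    Nat.mul_dvd_mul_left _ (Nat.dvd_factorial h1 h2)
  obtain ⟨C, hC⟩ := hP.exists_bound
  constructor
  · obtain ⟨x, hx⟩ := hne
    obtain ⟨s, t, hst, htB, hslab⟩ := hB x hx
    obtain ⟨m, rfl⟩ := Nat.exists_eq_add_of_lt hst
    obtain ⟨y, hy, hyper, -⟩ := hlocal.exists_periodic hu (hlocal.shift_mem hx (s • u))
      (m := m + 1) (by omega) (by
        intro w hw
        have := hslab w hw
        simp only [shift_apply]
        rw [this]; congr 1
        rw [add_assoc s m 1, add_smul]; abel)
    exact ⟨y, hy, isPeriodicMod_of_periods hD (le_periods_of_mem hy) hyper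
      (hdvd (m + 1) (by omega) (by omega))⟩
  · intro q hq x a ha
    rw [hasDensity_iff] at ha
    let Φ : ((Fin (c + 1) → ℤ) → A) → ℝ := fun x =>
      ∑ ω : Fin (c + 1) → ZMod D, extendZero Y f (shift (residueVec D ω) x)
    have hcyc : ∀ y ∈ (periodicPart Y L).carrier, ∀ m : ℕ, 0 < m → m ≤ stateBound R →
        (∀ v, y (m • u + v) = y v) →
        m * ((D : ℝ) ^ (c + 1) * q) ≤ ∑ j ∈ Finset.range m, Φ (shift (j • u) y) := by
      intro y hy m hm hmB hper
      have h1 := sum_cycle_eq (g := fun v => extendZero Y f (shift v y)) (fun v => hC _) hm hD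
        ((le_periods_of_mem hy).trans (periods_le_periods_shift y _))
        (periods_le_periods_shift y _ hper) (hdvd m hm hmB)
      have h2 := hq y hy
        (isPeriodicMod_of_periods hD (le_periods_of_mem hy) hper (hdvd m hm hmB))
      simp only [shift_add] at h1
      simp only [Φ]
      rw [h1]
      exact mul_le_mul_of_nonneg_left (mul_le_mul_of_nonneg_left h2 (by positivity))
        (by positivity)
    have hΦ : ∀ x ∈ (periodicPart Y L).carrier, ∀ y ∈ (periodicPart Y L).carrier,
        (∀ w, |φ w| ≤ (K : ℤ) → x w = y w) → Φ x = Φ y := by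
      intro x hx y hy hxy
      refine Finset.sum_congr rfl fun ω _ => ?_
      refine hP.extendZero_congr (Y.mapsTo _ hx.1) (Y.mapsTo _ hy.1) fun w hw => ?_
      refine hxy _ (hφK _ fun j => (abs_add_le _ _).trans (add_le_add ?_ (hw j)))
      have : (residueVec D ω) j = ((ω j).val : ℤ) := rfl
      rw [this, abs_of_nonneg (by positivity)]
      exact_mod_cast (ZMod.val_lt (ω j)).le
    have hΦC : ∀ x ∈ (periodicPart Y L).carrier, |Φ x| ≤ (D : ℝ) ^ (c + 1) * C := by
      intro x _
      calc |Φ x| ≤ ∑ ω : Fin (c + 1) → ZMod D, |extendZero Y f (shift (residueVec D ω) x)| :=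
            Finset.abs_sum_le_sum_abs _ _
        _ ≤ ∑ _ω : Fin (c + 1) → ZMod D, C := Finset.sum_le_sum fun ω _ => hC _
        _ = _ := by simp [ZMod.card]
    have hsum := fun n => hlocal.sum_ge hu hB hΦC hΦ hcyc n
    set E := (stateBound R : ℝ) * ((D : ℝ) ^ (c + 1) * C + |(D : ℝ) ^ (c + 1) * q|) with hE
    have hD0 : (0 : ℝ) < (D : ℝ) ^ (c + 1) :=
      pow_pos (by exact_mod_cast Nat.pos_of_ne_zero (NeZero.ne D)) _
    -- The bound on orbit sums holds at every position, so it passes to the density `a` with an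
    -- error `E` independent of `n`. Taking `n` large then forces `q ≤ a`.
    have hN : ∀ n : ℕ, (n : ℝ) * ((D : ℝ) ^ (c + 1) * (q - a)) ≤ E := by
      intro n
      have h1 := le_mul_of_tendsto_boxAverage
        (Finset.range n ×ˢ (Finset.univ : Finset (Fin (c + 1) → ZMod D)))
        (fun i => i.1 • u + residueVec D i.2) (fun v => hC _) ha
        (c := n * ((D : ℝ) ^ (c + 1) * q) - E) (by
          intro v
          have h2 := hsum n (shift v x.1) (hlocal.shift_mem x.2 v)
          rw [Finset.sum_product]
          simpa only [Φ, shift_add] using h2)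
      simp only [Finset.card_product, Finset.card_range, Finset.card_univ, Fintype.card_pi,
        ZMod.card, Finset.prod_const, Fintype.card_fin, Nat.cast_mul, Nat.cast_pow] at h1
      linarith
    by_contra! hlt
    have hpos : 0 < (D : ℝ) ^ (c + 1) * (q - a) := mul_pos hD0 (by linarith)
    obtain ⟨n, hn⟩ := exists_nat_gt (E / ((D : ℝ) ^ (c + 1) * (q - a)))
    rw [div_lt_iff₀ hpos] at hn
    linarith [hN n]

lemma hasDensity_periodicAverage [T2Space A] {d M : ℕ} [NeZero M] {Y : Subshift A (Fin d → ℤ)}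
    {f : Y.carrier → ℚ} {F : List (Pattern A (Fin d → ℤ))}
    {T : List (Pattern A (Fin d → ℤ) × ℚ)} {R : ℕ} (hP : IsPresentation Y f F T R)
    {L : AddSubgroup (Fin d → ℤ)} (x : (periodicPart Y L).carrier) (hx : IsPeriodicMod M x.1) :
    HasDensity (periodicPart Y L) (restrictPeriodic Y L f) x (periodicAverage Y f M x.1) := by
  obtain ⟨C, hC⟩ := hP.exists_bound
  rw [hasDensity_iff]
  exact tendsto_boxAverage_of_isPeriodicMod (fun v => hC _) (hx.shift _)

end Density

/-! ### Existence of finite descriptions. -/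

section Descriptions

lemma exists_generators {d : ℕ} (L : AddSubgroup (Fin d → ℤ)) :
    ∃ G : List (Fin d → ℤ), L = AddSubgroup.closure {v | v ∈ G} := by
  have h : (AddSubgroup.toIntSubmodule L).FG := IsNoetherian.noetherian _
  obtain ⟨S, hS⟩ := (Submodule.fg_iff_addSubgroup_fg _).1 h
  exact ⟨S.toList, by simpa using hS.symm⟩

variable {d k : ℕ} {A : Type*} [Inhabited A]

/-- The list of the entries of a pattern. -/
noncomputable def encodePattern (e : A ≃ Fin k) (P : Pattern A (Fin d → ℤ)) : PatternCode :=
  P.support.toList.map fun v => (List.ofFn v, (e (P.config v) : ℕ))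

lemma encodePattern_describes (e : A ≃ Fin k) (P : Pattern A (Fin d → ℤ)) :
    PatternCode.Describes e (encodePattern e P) P := by
  intro t
  simp only [encodePattern, List.mem_map, Finset.mem_toList]
  exact ⟨fun ⟨v, hv, h⟩ => ⟨v, hv, h.symm⟩, fun ⟨v, hv, h⟩ => ⟨v, hv, h.symm⟩⟩

lemma ratCode_describes (q : ℚ) : RatCode.Describes (q.num, q.den) q :=
  ⟨q.den_ne_zero, (Rat.num_div_den q).symm⟩

lemma fromConfig_occursInAt_iff {G : Type*} [AddMonoid G] (x y : G → A) (U : Finset G) :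
    (Pattern.fromConfig x U).occursInAt y 0 ↔ y ∈ cylinder U x := by
  simp only [Pattern.occursInAt, Pattern.fromConfig, cylinder, zero_add, Set.mem_ofPred_eq]
  exact forall₂_congr fun v hv => by rw [if_pos hv]

variable [TopologicalSpace A] [DiscreteTopology A]

/-- A continuous function with finite range has open fibres, so it is constant on a cylinder around
each point; by compactness finitely many cylinders suffice. -/
lemma IsSimpleContinuous.exists_table [Finite A] {Y : Subshift A (Fin d → ℤ)} {f : Y.carrier → ℚ}
    (hf : IsSimpleContinuous f) : ∃ T : List (Pattern A (Fin d → ℤ) × ℚ),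
      (∀ x : Y.carrier, ∃ t ∈ T, t.1.occursInAt x.1 0) ∧
      (∀ x : Y.carrier, ∀ t ∈ T, t.1.occursInAt x.1 0 → f x = t.2) := by
  classical
  have hopen : ∀ q : ℚ, IsOpen (f ⁻¹' {q}) := by
    intro q
    have h1 : f ⁻¹' {q} = (f ⁻¹' (Set.range f \ {q}))ᶜ := by
      ext x; simp
    rw [h1, isOpen_compl_iff]
    exact (hf.2.subset Set.sdiff_subset).isClosed.preimage hf.1
  have hloc : ∀ x : Y.carrier, ∃ U : Finset (Fin d → ℤ),
      ∀ y : Y.carrier, y.1 ∈ cylinder U x.1 → f y = f x := by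
    intro x
    obtain ⟨W, hW, hWf⟩ := isOpen_induced_iff.1 (hopen (f x))
    have hxW : x.1 ∈ W := by
      have : x ∈ Subtype.val ⁻¹' W := by rw [hWf]; rfl
      exact this
    obtain ⟨U, t, ht, htW⟩ := isOpen_pi_iff.1 hW x.1 hxW
    refine ⟨U, fun y hy => ?_⟩
    have : y ∈ Subtype.val ⁻¹' W := by
      refine htW fun i hi => ?_
      rw [hy i hi]
      exact (ht i hi).2
    rw [hWf] at this
    exact this
  choose U hU using hloc
  have hcomp : IsCompact Y.carrier := Y.isClosed.isCompact
  obtain ⟨s, hs⟩ := hcomp.elim_finite_subcover (fun x : Y.carrier => cylinder (U x) x.1)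
    (fun x => isOpen_cylinder _ _)
    (fun x hx => Set.mem_iUnion.2 ⟨⟨x, hx⟩, fun _ _ => rfl⟩)
  refine ⟨s.toList.map fun x => (Pattern.fromConfig x.1 (U x), f x), fun x => ?_, fun x t ht => ?_⟩
  · obtain ⟨y, hy⟩ := Set.mem_iUnion.1 (hs x.2)
    obtain ⟨hys, hxy⟩ := Set.mem_iUnion.1 hy
    exact ⟨_, List.mem_map.2 ⟨y, Finset.mem_toList.2 hys, rfl⟩,
      (fromConfig_occursInAt_iff _ _ _).2 hxy⟩
  · obtain ⟨y, -, rfl⟩ := List.mem_map.1 ht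
    exact fun hocc => hU y x ((fromConfig_occursInAt_iff _ _ _).1 hocc)

lemma exists_describes [Finite A] {Y : Subshift A (Fin d → ℤ)} {f : Y.carrier → ℚ}
    (L : AddSubgroup (Fin d → ℤ)) (hY : IsSFT Y) (hf : IsSimpleContinuous f) :
    ∃ w : InputCode, Describes w Y f L := by
  obtain ⟨F, hF, hYF⟩ := hY
  obtain ⟨T, hT1, hT2⟩ := hf.exists_table
  obtain ⟨G, hG⟩ := exists_generators L
  let e := Finite.equivFin A
  refine ⟨_, _, e, hF.toFinset.toList.map (encodePattern e),
    T.map (fun t => (encodePattern e t.1, (t.2.num, t.2.den))), G.map List.ofFn, rfl,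
    ⟨hF.toFinset.toList, ?_, by simpa using hYF⟩, ⟨T, ?_, hT1, hT2⟩, G, rfl, hG⟩
  · rw [List.forall₂_map_left_iff, List.forall₂_same]
    exact fun P _ => encodePattern_describes e P
  · rw [List.forall₂_map_left_iff, List.forall₂_same]
    exact fun t _ => ⟨encodePattern_describes e t.1, ratCode_describes t.2⟩

end Descriptions

/-! ### Primitive recursive arithmetic on naturals, integers and lists. -/

section PrimrecLemmas

variable {α β : Type*} [Primcodable α] [Primcodable β]

lemma primrec_nat_pow : Primrec₂ ((· ^ ·) : ℕ → ℕ → ℕ) :=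
  Primrec₂.unpaired'.1 Nat.Primrec.pow

lemma primrec_factorial : Primrec Nat.factorial :=
  (Primrec.nat_rec₁ 1 (f := fun n m => (n + 1) * m)
    (Primrec.nat_mul.comp (Primrec.succ.comp Primrec.fst) Primrec.snd)).of_eq fun n => by
      induction n with
      | zero => rfl
      | succ n ih => rw [Nat.factorial_succ, ← ih]

lemma primrec_list_sum : Primrec (List.sum : List ℕ → ℕ) :=
  Primrec.list_foldr (h := fun _ (x : ℕ × ℕ) => x.1 + x.2) Primrec.id (Primrec.const 0)
    (Primrec.nat_add.comp (Primrec.fst.comp Primrec.snd) (Primrec.snd.comp Primrec.snd))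

lemma primrec_list_prod : Primrec (List.prod : List ℕ → ℕ) :=
  Primrec.list_foldr (h := fun _ (x : ℕ × ℕ) => x.1 * x.2) Primrec.id (Primrec.const 1)
    (Primrec.nat_mul.comp (Primrec.fst.comp Primrec.snd) (Primrec.snd.comp Primrec.snd))

lemma primrecPred_forall_mem {l : α → List β} {p : α → β → Prop} (hl : Primrec l)
    (hp : PrimrecRel p) : PrimrecPred fun a => ∀ b ∈ l a, p a b :=
  (PrimrecRel.forall_mem_list hp.swap).comp hl Primrec.id

lemma primrecPred_exists_mem {l : α → List β} {p : α → β → Prop} (hl : Primrec l)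
    (hp : PrimrecRel p) : PrimrecPred fun a => ∃ b ∈ l a, p a b :=
  (PrimrecRel.exists_mem_list hp.swap).comp hl Primrec.id

/-- The code of an integer is `2 * n` or `2 * n + 1` according to its constructor, so parity decides
the case and halving recovers `n`. -/
lemma primrec_int_casesOn {z : α → ℤ} {f g : α → ℕ → β} (hz : Primrec z) (hf : Primrec₂ f)
    (hg : Primrec₂ g) :
    Primrec fun a => (Int.casesOn (z a) (fun n => f a n) (fun n => g a n) : β) := by
  have he : Primrec fun a => Encodable.encode (z a) := Primrec.encode.comp hz
  have hdiv : Primrec fun a => (Encodable.encode (z a)).div2 := Primrec.nat_div2.comp he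
  refine (Primrec.cond (Primrec.nat_bodd.comp he) (hg.comp Primrec.id hdiv)
    (hf.comp Primrec.id hdiv)).of_eq fun a => ?_
  rcases z a with n | n
  · have : Encodable.encode (Int.ofNat n) = 2 * n := rfl
    rw [this]
    simp [Nat.div2_val]
  · have : Encodable.encode (Int.negSucc n) = 2 * n + 1 := rfl
    rw [this]
    simp

lemma primrec_int_ofNat : Primrec Int.ofNat :=
  Primrec.encode_iff.1 (Primrec.nat_double.of_eq fun _ => rfl)

lemma primrec_int_negSucc : Primrec Int.negSucc :=
  Primrec.encode_iff.1 (Primrec.nat_double_succ.of_eq fun _ => rfl)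

lemma primrec_int_toNat : Primrec Int.toNat :=
  (primrec_int_casesOn (f := fun _ n => n) (g := fun _ _ => 0) Primrec.id Primrec.snd
    (Primrec.const 0)).of_eq fun z => by cases z <;> rfl

lemma primrec_int_toNat_neg : Primrec fun z : ℤ => (-z).toNat :=
  (primrec_int_casesOn (f := fun _ _ => 0) (g := fun _ n => n + 1) Primrec.id (Primrec.const 0)
    (Primrec.succ.comp Primrec.snd)).of_eq fun z => by
      cases z with
      | ofNat n => exact (Int.toNat_neg_natCast n).symm
      | negSucc n => rfl

lemma primrec_int_subNat : Primrec₂ fun s t : ℕ => (s : ℤ) - (t : ℤ) := by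
  have h : Primrec fun p : ℕ × ℕ => if p.2 ≤ p.1 then Int.ofNat (p.1 - p.2)
      else Int.negSucc (Nat.pred (p.2 - p.1)) :=
    Primrec.ite (Primrec.nat_le.comp Primrec.snd Primrec.fst)
      (primrec_int_ofNat.comp (Primrec.nat_sub.comp Primrec.fst Primrec.snd))
      (primrec_int_negSucc.comp (Primrec.pred.comp (Primrec.nat_sub.comp Primrec.snd Primrec.fst)))
  refine h.of_eq fun p => ?_
  split_ifs with hp
  · simp [Nat.cast_sub hp]
  · rw [Nat.pred_eq_sub_one]
    dsimp only
    omega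

/-- The residue of an integer modulo a positive natural number. -/
def intMod (z : ℤ) (M : ℕ) : ℕ :=
  Int.casesOn z (fun n => n % M) (fun n => M - 1 - n % M)

lemma primrec_intMod : Primrec₂ intMod :=
  primrec_int_casesOn (α := ℤ × ℕ) (f := fun a n => n % a.2) (g := fun a n => a.2 - 1 - n % a.2)
    Primrec.fst (Primrec.nat_mod.comp Primrec.snd (Primrec.snd.comp Primrec.fst))
    (Primrec.nat_sub.comp (Primrec.pred.comp (Primrec.snd.comp Primrec.fst))
      (Primrec.nat_mod.comp Primrec.snd (Primrec.snd.comp Primrec.fst)))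

lemma intMod_cast (z : ℤ) {M : ℕ} (hM : 0 < M) : (intMod z M : ℤ) = z % M := by
  rcases z with n | n
  · simp [intMod]
  · have h1 := Nat.mod_lt n hM
    rw [Int.negSucc_emod _ (by exact_mod_cast hM)]
    simp only [intMod]
    omega

lemma intMod_lt (z : ℤ) {M : ℕ} (hM : 0 < M) : intMod z M < M := by
  have h := Int.emod_lt_of_pos z (by exact_mod_cast hM : (0 : ℤ) < M)
  rw [← intMod_cast z hM] at h
  exact_mod_cast h

end PrimrecLemmas

/-! ### The search algorithm and its computability. -/

section Algorithm

/-- The index of the position `b + p` modulo `M`, the position `b` being given by its index. -/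
def digitIndex (d M b : ℕ) (p : List ℤ) : ℕ :=
  ((List.range d).map fun j => (b / M ^ j + intMod (p.getD j 0) M) % M * M ^ j).sum

/-- The symbol at `b + p` in the `M`-periodic configuration of index `n`. -/
def symbolAt (d k M n b : ℕ) (p : List ℤ) : ℕ :=
  n / k ^ digitIndex d M b p % k

/-- Whether a written pattern occurs at the position `b` in the configuration of index `n`. -/
def matchesAt (d k M n b : ℕ) (c : PatternCode) : Bool :=
  decide (∀ t ∈ c, symbolAt d k M n b t.1 = t.2)

/-- Whether the configuration of index `n` avoids the patterns in `cY` and has the periods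
in `cL`. -/
def isValid (d k M : ℕ) (cY : List PatternCode) (cL : List (List ℤ)) (n : ℕ) : Bool :=
  decide (∀ b ∈ List.range (M ^ d), (∀ g ∈ cL, symbolAt d k M n b g = symbolAt d k M n b []) ∧
    ∀ c ∈ cY, matchesAt d k M n b c = false)

/-- A common denominator of the values in a written table. -/
def commonDen (cf : List (PatternCode × RatCode)) : ℕ :=
  (cf.map fun t => t.2.2).prod

/-- A number which, added to the values of a written table multiplied by the common denominator,
makes them nonnegative. -/
def offset (cf : List (PatternCode × RatCode)) : ℕ :=
  (cf.map fun t => (-t.2.1).toNat * commonDen cf).sum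

/-- The value `q`, multiplied by the common denominator and increased by the offset. -/
def scaledValue (cf : List (PatternCode × RatCode)) (q : RatCode) : ℕ :=
  offset cf + q.1.toNat * (commonDen cf / q.2) - (-q.1).toNat * (commonDen cf / q.2)

/-- The scaled value at the position `b` in the configuration of index `n`. -/
def cellValue (d k M : ℕ) (cf : List (PatternCode × RatCode)) (n b : ℕ) : ℕ :=
  cf.foldr (fun t r => bif matchesAt d k M n b t.1 then scaledValue cf t.2 else r) 0

/-- The sum of the scaled values over a period of the configuration of index `n`. -/
def totalValue (d k M : ℕ) (cf : List (PatternCode × RatCode)) (n : ℕ) : ℕ :=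
  ((List.range (M ^ d)).map fun b => cellValue d k M cf n b).sum

/-- Whether `s` is the total value of some valid configuration. -/
def isAttained (w : InputCode) (M s : ℕ) : Bool :=
  decide (∃ n ∈ List.range (w.2.1 ^ M ^ w.1), isValid w.1 w.2.1 M w.2.2.1 w.2.2.2.2 n = true ∧
    totalValue w.1 w.2.1 M w.2.2.2.1 n = s)

/-- The period used for an input. -/
def inputPeriod (w : InputCode) : ℕ := commonPeriod (Encodable.encode w + 1)

/-- The algorithm computing the minimum density: it determines the least total value of the
configurations with the common period. -/
def minDensityAlgorithm (w : InputCode) : Part RatCode :=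
  (Nat.rfind fun s => Part.some (isAttained w (inputPeriod w) s)).map fun s : ℕ =>
    ((s : ℤ) - ((offset w.2.2.2.1 * inputPeriod w ^ w.1 : ℕ) : ℤ),
      commonDen w.2.2.2.1 * inputPeriod w ^ w.1)

variable {α : Type*} [Primcodable α]

lemma primrec_digitIndex {d M b : α → ℕ} {p : α → List ℤ} (hd : Primrec d) (hM : Primrec M)
    (hb : Primrec b) (hp : Primrec p) : Primrec fun a => digitIndex (d a) (M a) (b a) (p a) := by
  refine primrec_list_sum.comp (Primrec.list_map (Primrec.list_range.comp hd) ?_)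
  have hM' : Primrec fun x : α × ℕ => M x.1 := hM.comp Primrec.fst
  have hpow : Primrec fun x : α × ℕ => M x.1 ^ x.2 := primrec_nat_pow.comp hM' Primrec.snd
  exact Primrec.nat_mul.comp (Primrec.nat_mod.comp (Primrec.nat_add.comp
    (Primrec.nat_div.comp (hb.comp Primrec.fst) hpow)
    (primrec_intMod.comp ((Primrec.list_getD 0).comp (hp.comp Primrec.fst) Primrec.snd) hM'))
    hM') hpow

lemma primrec_symbolAt {d k M n b : α → ℕ} {p : α → List ℤ} (hd : Primrec d) (hk : Primrec k)
    (hM : Primrec M) (hn : Primrec n) (hb : Primrec b) (hp : Primrec p) :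
    Primrec fun a => symbolAt (d a) (k a) (M a) (n a) (b a) (p a) :=
  Primrec.nat_mod.comp
    (Primrec.nat_div.comp hn (primrec_nat_pow.comp hk (primrec_digitIndex hd hM hb hp))) hk

lemma primrec_matchesAt {d k M n b : α → ℕ} {c : α → PatternCode} (hd : Primrec d)
    (hk : Primrec k) (hM : Primrec M) (hn : Primrec n) (hb : Primrec b) (hc : Primrec c) :
    Primrec fun a => matchesAt (d a) (k a) (M a) (n a) (b a) (c a) := by
  refine PrimrecPred.decide (primrecPred_forall_mem hc (PrimrecRel.comp Primrec.eq ?_ ?_))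
  · exact primrec_symbolAt (hd.comp Primrec.fst) (hk.comp Primrec.fst) (hM.comp Primrec.fst)
      (hn.comp Primrec.fst) (hb.comp Primrec.fst) (Primrec.fst.comp Primrec.snd)
  · exact Primrec.snd.comp Primrec.snd

lemma primrec_isValid {d k M n : α → ℕ} {cY : α → List PatternCode} {cL : α → List (List ℤ)}
    (hd : Primrec d) (hk : Primrec k) (hM : Primrec M) (hY : Primrec cY) (hL : Primrec cL)
    (hn : Primrec n) : Primrec fun a => isValid (d a) (k a) (M a) (cY a) (cL a) (n a) := by
  refine PrimrecPred.decide (primrecPred_forall_mem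
    (Primrec.list_range.comp (primrec_nat_pow.comp hM hd)) (PrimrecPred.and ?_ ?_))
  · refine primrecPred_forall_mem (hL.comp Primrec.fst) (PrimrecRel.comp Primrec.eq ?_ ?_)
    · exact primrec_symbolAt (hd.comp (Primrec.fst.comp Primrec.fst))
        (hk.comp (Primrec.fst.comp Primrec.fst)) (hM.comp (Primrec.fst.comp Primrec.fst))
        (hn.comp (Primrec.fst.comp Primrec.fst)) (Primrec.snd.comp Primrec.fst) Primrec.snd
    · exact primrec_symbolAt (hd.comp (Primrec.fst.comp Primrec.fst))
        (hk.comp (Primrec.fst.comp Primrec.fst)) (hM.comp (Primrec.fst.comp Primrec.fst))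
        (hn.comp (Primrec.fst.comp Primrec.fst)) (Primrec.snd.comp Primrec.fst) (Primrec.const [])
  · refine primrecPred_forall_mem (hY.comp Primrec.fst)
      (PrimrecRel.comp Primrec.eq ?_ (Primrec.const false))
    exact primrec_matchesAt (hd.comp (Primrec.fst.comp Primrec.fst))
      (hk.comp (Primrec.fst.comp Primrec.fst)) (hM.comp (Primrec.fst.comp Primrec.fst))
      (hn.comp (Primrec.fst.comp Primrec.fst)) (Primrec.snd.comp Primrec.fst) Primrec.snd

lemma primrec_commonDen : Primrec commonDen :=
  primrec_list_prod.comp (Primrec.list_map Primrec.id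
    (Primrec.snd.comp (Primrec.snd.comp Primrec.snd)))

lemma primrec_offset : Primrec offset :=
  primrec_list_sum.comp (Primrec.list_map Primrec.id (Primrec.nat_mul.comp
    (primrec_int_toNat_neg.comp (Primrec.fst.comp (Primrec.snd.comp Primrec.snd)))
    (primrec_commonDen.comp Primrec.fst)))

lemma primrec_scaledValue : Primrec₂ scaledValue := by
  have hq : Primrec fun x : List (PatternCode × RatCode) × RatCode => commonDen x.1 / x.2.2 :=
    Primrec.nat_div.comp (primrec_commonDen.comp Primrec.fst) (Primrec.snd.comp Primrec.snd)
  exact Primrec.nat_sub.comp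
    (Primrec.nat_add.comp (primrec_offset.comp Primrec.fst)
      (Primrec.nat_mul.comp (primrec_int_toNat.comp (Primrec.fst.comp Primrec.snd)) hq))
    (Primrec.nat_mul.comp (primrec_int_toNat_neg.comp (Primrec.fst.comp Primrec.snd)) hq)

lemma primrec_cellValue {d k M n b : α → ℕ} {cf : α → List (PatternCode × RatCode)}
    (hd : Primrec d) (hk : Primrec k) (hM : Primrec M) (hf : Primrec cf) (hn : Primrec n)
    (hb : Primrec b) : Primrec fun a => cellValue (d a) (k a) (M a) (cf a) (n a) (b a) := by
  refine Primrec.list_foldr (h := fun a (x : (PatternCode × RatCode) × ℕ) =>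
    bif matchesAt (d a) (k a) (M a) (n a) (b a) x.1.1 then scaledValue (cf a) x.1.2 else x.2)
    hf (Primrec.const 0) (Primrec.cond ?_ ?_ (Primrec.snd.comp Primrec.snd))
  · exact primrec_matchesAt (hd.comp Primrec.fst) (hk.comp Primrec.fst) (hM.comp Primrec.fst)
      (hn.comp Primrec.fst) (hb.comp Primrec.fst)
      (Primrec.fst.comp (Primrec.fst.comp Primrec.snd))
  · exact primrec_scaledValue.comp (hf.comp Primrec.fst)
      (Primrec.snd.comp (Primrec.fst.comp Primrec.snd))

lemma primrec_totalValue {d k M n : α → ℕ} {cf : α → List (PatternCode × RatCode)}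
    (hd : Primrec d) (hk : Primrec k) (hM : Primrec M) (hf : Primrec cf) (hn : Primrec n) :
    Primrec fun a => totalValue (d a) (k a) (M a) (cf a) (n a) :=
  primrec_list_sum.comp (Primrec.list_map (Primrec.list_range.comp (primrec_nat_pow.comp hM hd))
    (primrec_cellValue (hd.comp Primrec.fst) (hk.comp Primrec.fst) (hM.comp Primrec.fst)
      (hf.comp Primrec.fst) (hn.comp Primrec.fst) Primrec.snd))

lemma primrec_isAttained {w : α → InputCode} {M s : α → ℕ} (hw : Primrec w) (hM : Primrec M)
    (hs : Primrec s) : Primrec fun a => isAttained (w a) (M a) (s a) := by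
  have hd : Primrec fun a => (w a).1 := Primrec.fst.comp hw
  have h1 : Primrec fun a => (w a).2 := Primrec.snd.comp hw
  have hk : Primrec fun a => (w a).2.1 := Primrec.fst.comp h1
  have h2 : Primrec fun a => (w a).2.2 := Primrec.snd.comp h1
  have hY : Primrec fun a => (w a).2.2.1 := Primrec.fst.comp h2
  have h3 : Primrec fun a => (w a).2.2.2 := Primrec.snd.comp h2
  have hf : Primrec fun a => (w a).2.2.2.1 := Primrec.fst.comp h3
  have hL : Primrec fun a => (w a).2.2.2.2 := Primrec.snd.comp h3
  refine PrimrecPred.decide (primrecPred_exists_mem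
    (Primrec.list_range.comp (primrec_nat_pow.comp hk (primrec_nat_pow.comp hM hd)))
    (PrimrecPred.and (PrimrecRel.comp Primrec.eq ?_ (Primrec.const true))
      (PrimrecRel.comp Primrec.eq ?_ (hs.comp Primrec.fst))))
  · exact primrec_isValid (hd.comp Primrec.fst) (hk.comp Primrec.fst) (hM.comp Primrec.fst)
      (hY.comp Primrec.fst) (hL.comp Primrec.fst) Primrec.snd
  · exact primrec_totalValue (hd.comp Primrec.fst) (hk.comp Primrec.fst) (hM.comp Primrec.fst)
      (hf.comp Primrec.fst) Primrec.snd

lemma primrec_commonPeriod : Primrec commonPeriod := by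
  have hdet : Primrec detBound :=
    Primrec.nat_mul.comp primrec_factorial (primrec_nat_pow.comp Primrec.id Primrec.id)
  have hmod : Primrec modulus := primrec_factorial.comp hdet
  have hslab : Primrec slabWidth := Primrec.nat_mul.comp (Primrec.nat_mul.comp Primrec.id hdet)
    (Primrec.nat_add.comp hmod Primrec.id)
  have hbox : Primrec boxRadius :=
    Primrec.nat_add.comp (Primrec.nat_mul.comp Primrec.id Primrec.id) hslab
  have hstate : Primrec stateBound := primrec_nat_pow.comp Primrec.id
    (primrec_nat_pow.comp (Primrec.nat_double_succ.comp hbox) Primrec.id)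
  exact Primrec.nat_mul.comp hmod (primrec_factorial.comp hstate)

lemma primrec_inputPeriod : Primrec inputPeriod :=
  primrec_commonPeriod.comp (Primrec.succ.comp Primrec.encode)

theorem partrec_minDensityAlgorithm : Partrec minDensityAlgorithm := by
  have hf : Primrec fun w : InputCode => w.2.2.2.1 :=
    Primrec.fst.comp (Primrec.snd.comp (Primrec.snd.comp Primrec.snd))
  have hvol : Primrec fun w : InputCode => inputPeriod w ^ w.1 :=
    primrec_nat_pow.comp primrec_inputPeriod Primrec.fst
  refine Partrec.map (Partrec.rfind ?_) (Primrec.to_comp ?_)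
  · exact (primrec_isAttained Primrec.fst (primrec_inputPeriod.comp Primrec.fst)
      Primrec.snd).to_comp.partrec
  · exact Primrec.pair
      (primrec_int_subNat.comp Primrec.snd
        (Primrec.nat_mul.comp (primrec_offset.comp (hf.comp Primrec.fst))
          (hvol.comp Primrec.fst)))
      (Primrec.nat_mul.comp (primrec_commonDen.comp (hf.comp Primrec.fst))
        (hvol.comp Primrec.fst))

end Algorithm

/-! ### Numbering the points of a period box by base `M` digits. -/

section Indexing

lemma sum_digits_div_pow {n m : ℕ} {g : Fin n → ℕ} (hg : ∀ i, g i < m) (j : Fin n) :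
    (∑ i, g i * m ^ (i : ℕ)) / m ^ (j : ℕ) % m = g j := by
  exact congrArg Fin.val (congrFun (finFunctionFinEquiv.symm_apply_apply
    (fun i => (⟨g i, hg i⟩ : Fin m))) j)

lemma sum_digits_lt {n m : ℕ} {g : Fin n → ℕ} (hg : ∀ i, g i < m) :
    ∑ i, g i * m ^ (i : ℕ) < m ^ n := by
  have h := (finFunctionFinEquiv (fun i => (⟨g i, hg i⟩ : Fin m))).2
  rwa [finFunctionFinEquiv_apply] at h

variable {d : ℕ}

/-- The position in `[0, M)^d` with the given index. -/
def indexPoint (d M b : ℕ) : Fin d → ℤ := fun j => ((b / M ^ (j : ℕ) % M : ℕ) : ℤ)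

/-- The index of a position modulo `M`. -/
def pointIndex (M : ℕ) (v : Fin d → ℤ) : ℕ := ∑ j, intMod (v j) M * M ^ (j : ℕ)

lemma pointIndex_lt {M : ℕ} (hM : 0 < M) (v : Fin d → ℤ) : pointIndex M v < M ^ d :=
  sum_digits_lt fun j => intMod_lt (v j) hM

lemma indexPoint_pointIndex {M : ℕ} (hM : 0 < M) (v : Fin d → ℤ) (j : Fin d) :
    indexPoint d M (pointIndex M v) j = v j % M := by
  rw [indexPoint, pointIndex, sum_digits_div_pow (fun j => intMod_lt (v j) hM), intMod_cast _ hM]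

lemma pointIndex_congr {M : ℕ} (hM : 0 < M) {v v' : Fin d → ℤ}
    (h : ∀ j, (M : ℤ) ∣ v' j - v j) : pointIndex M v = pointIndex M v' := by
  refine Finset.sum_congr rfl fun j _ => ?_
  congr 1
  zify
  rw [intMod_cast _ hM, intMod_cast _ hM]
  exact (Int.emod_emod_of_dvd _ (dvd_refl _)).symm.trans
    ((Int.emod_emod_of_dvd _ (dvd_refl _)).trans (Int.modEq_iff_dvd.2 (h j)))

lemma digitIndex_eq {M : ℕ} (hM : 0 < M) (b : ℕ) {p : List ℤ} {v : Fin d → ℤ}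
    (hp : ∀ j : Fin d, p.getD j 0 = v j) :
    digitIndex d M b p = pointIndex M (indexPoint d M b + v) := by
  have h1 : digitIndex d M b p = ∑ j ∈ Finset.range d,
      (b / M ^ j + intMod (p.getD j 0) M) % M * M ^ j := by
    simp [digitIndex, Finset.sum, Finset.range, Multiset.range]
  rw [h1, Finset.sum_range]
  refine Finset.sum_congr rfl fun j _ => ?_
  congr 1
  zify
  rw [intMod_cast _ hM, intMod_cast _ hM, hp, Pi.add_apply, indexPoint]
  push_cast
  simp [Int.add_emod]

lemma sum_residueVec_eq_sum_range {M : ℕ} [NeZero M] (g : (Fin d → ℤ) → ℝ) :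
    ∑ ω : Fin d → ZMod M, g (residueVec M ω) = ∑ b ∈ Finset.range (M ^ d), g (indexPoint d M b) := by
  rw [Finset.sum_range]
  refine Fintype.sum_equiv ((Equiv.piCongrRight fun _ => (ZMod.finEquiv M).symm.toEquiv).trans
    finFunctionFinEquiv) _ _ fun ω => ?_
  congr 1
  funext j
  have hval : ∀ i : ZMod M, (((ZMod.finEquiv M).symm i : Fin M) : ℕ) = i.val := by
    obtain ⟨m, rfl⟩ := Nat.exists_eq_succ_of_ne_zero (NeZero.ne M)
    exact fun i => rfl
  have hd : ∀ j, (ω j).val < M := fun j => ZMod.val_lt (ω j)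
  have := sum_digits_div_pow hd j
  simp only [residueVec, indexPoint, Equiv.trans_apply, finFunctionFinEquiv_apply,
    Equiv.piCongrRight_apply, Pi.map_apply]
  rw [← this]
  simp only [← hval]
  rfl

end Indexing

/-! ### Correctness of the validity test. -/

section Semantics

variable {d k : ℕ} {A : Type*}

/-- The `M`-periodic configuration with the given index. -/
def indexedConfig (e : A ≃ Fin k) [NeZero k] (M n : ℕ) : (Fin d → ℤ) → A := fun v =>
  e.symm ⟨n / k ^ pointIndex M v % k, Nat.mod_lt _ (Nat.pos_of_ne_zero (NeZero.ne k))⟩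

variable {e : A ≃ Fin k} [NeZero k] {M : ℕ}

lemma indexedConfig_isPeriodicMod (hM : 0 < M) (n : ℕ) :
    IsPeriodicMod M (indexedConfig (d := d) e M n) := by
  intro v v' h
  simp only [indexedConfig, pointIndex_congr hM h]

lemma IsPeriodicMod.eq_indexPoint {E : Type*} {x : (Fin d → ℤ) → E} (hM : 0 < M)
    (hx : IsPeriodicMod M x) (v : Fin d → ℤ) : x v = x (indexPoint d M (pointIndex M v)) := by
  refine hx _ _ fun j => ?_
  rw [indexPoint_pointIndex hM]
  exact ⟨-(v j / M), by have := Int.emod_add_mul_ediv (v j) M; linarith⟩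

/-- The symbols on the period box, read as base `k` digits, form the index. -/
lemma IsPeriodicMod.exists_index (hM : 0 < M) {x : (Fin d → ℤ) → A} (hx : IsPeriodicMod M x) :
    ∃ n < k ^ M ^ d, indexedConfig e M n = x := by
  have hg : ∀ i : Fin (M ^ d), ((e (x (indexPoint d M i)) : Fin k) : ℕ) < k := fun i => Fin.is_lt _
  refine ⟨_, sum_digits_lt hg, funext fun v => ?_⟩
  have h := sum_digits_div_pow hg ⟨pointIndex M v, pointIndex_lt hM v⟩
  simp only [indexedConfig, h]
  rw [hx.eq_indexPoint hM v]
  simp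

lemma symbolAt_eq (hM : 0 < M) (n b : ℕ) {p : List ℤ} {v : Fin d → ℤ}
    (hp : ∀ j : Fin d, p.getD j 0 = v j) :
    symbolAt d k M n b p = (e (indexedConfig e M n (indexPoint d M b + v)) : ℕ) := by
  simp [symbolAt, indexedConfig, digitIndex_eq hM b hp]

lemma symbolAt_ofFn (hM : 0 < M) (n b : ℕ) (v : Fin d → ℤ) :
    symbolAt d k M n b (List.ofFn v) =
      (e (indexedConfig e M n (indexPoint d M b + v)) : ℕ) :=
  symbolAt_eq hM n b fun j => by simp [List.getD_eq_getElem?_getD]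

/-- Missing coordinates are read as `0`, so the empty list denotes the zero vector in every
dimension; the test for periods compares against it. -/
lemma symbolAt_nil (hM : 0 < M) (n b : ℕ) :
    symbolAt d k M n b [] = (e (indexedConfig e M n (indexPoint d M b)) : ℕ) := by
  rw [symbolAt_eq (e := e) (v := 0) hM n b fun j => by simp, add_zero]

lemma matchesAt_iff [Inhabited A] (hM : 0 < M) (n b : ℕ) {c : PatternCode}
    {P : Pattern A (Fin d → ℤ)} (hc : PatternCode.Describes e c P) :
    matchesAt d k M n b c = true ↔ P.occursInAt (indexedConfig e M n) (indexPoint d M b) := by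
  rw [matchesAt, decide_eq_true_iff]
  constructor
  · intro h v hv
    have := h _ ((hc _).2 ⟨v, hv, rfl⟩)
    rw [symbolAt_ofFn (e := e) hM] at this
    exact e.injective (Fin.ext this)
  · intro h t ht
    obtain ⟨v, hv, rfl⟩ := (hc t).1 ht
    dsimp only
    rw [symbolAt_ofFn (e := e) hM, h v hv]

lemma exists_right_of_forall₂ {α β : Type*} {R : α → β → Prop} {l : List α} {l' : List β}
    (h : List.Forall₂ R l l') {a : α} (ha : a ∈ l) : ∃ b ∈ l', R a b := by
  induction h with
  | nil => simp at ha
  | cons hab _ ih =>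
    rcases List.mem_cons.1 ha with rfl | ha
    · exact ⟨_, List.mem_cons_self, hab⟩
    · obtain ⟨b, hb, hR⟩ := ih ha
      exact ⟨b, List.mem_cons_of_mem _ hb, hR⟩

lemma exists_left_of_forall₂ {α β : Type*} {R : α → β → Prop} {l : List α} {l' : List β}
    (h : List.Forall₂ R l l') {b : β} (hb : b ∈ l') : ∃ a ∈ l, R a b :=
  exists_right_of_forall₂ h.flip hb

lemma isValid_iff [Inhabited A] [TopologicalSpace A] [T2Space A] (hM : 0 < M) (n : ℕ)
    {Y : Subshift A (Fin d → ℤ)} {cY : List PatternCode} {F : List (Pattern A (Fin d → ℤ))}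
    (hF : List.Forall₂ (PatternCode.Describes e) cY F) (hY : Y.carrier = forbidden {P | P ∈ F})
    {L : AddSubgroup (Fin d → ℤ)} {G : List (Fin d → ℤ)}
    (hL : L = AddSubgroup.closure {v | v ∈ G}) :
    isValid d k M cY (G.map List.ofFn) n = true ↔
      indexedConfig e M n ∈ (periodicPart Y L).carrier := by
  have hper := indexedConfig_isPeriodicMod (d := d) (e := e) hM n
  rw [isValid, decide_eq_true_iff]
  constructor
  · intro h
    refine ⟨?_, ?_⟩
    · rw [hY]
      intro P hP v hocc
      obtain ⟨c, hc, hcP⟩ := exists_left_of_forall₂ hF hP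
      have h1 := (h _ (List.mem_range.2 (pointIndex_lt hM v))).2 c hc
      rw [Bool.eq_false_iff, Ne, matchesAt_iff hM n _ hcP] at h1
      refine h1 fun w hw => ?_
      have h2 := (hper.shift (fun x : (Fin d → ℤ) → A => x w)).eq_indexPoint hM v
      simp only [shift_apply] at h2
      rw [← h2]
      exact hocc w hw
    · have hG : ∀ g ∈ G, g ∈ periods (indexedConfig (d := d) e M n) := by
        intro g hg v
        have h1 := (h _ (List.mem_range.2 (pointIndex_lt hM v))).1 _
          (List.mem_map_of_mem (f := List.ofFn) hg)
        rw [symbolAt_ofFn (e := e) hM, symbolAt_nil (e := e) hM] at h1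
        have h2 := e.injective (Fin.ext h1)
        rw [← hper.eq_indexPoint hM v] at h2
        rw [← h2, add_comm]
        exact (hper.shift (fun x : (Fin d → ℤ) → A => x g)).eq_indexPoint hM v
      have hLe : L ≤ periods (indexedConfig (d := d) e M n) := by
        rw [hL, AddSubgroup.closure_le]
        exact hG
      exact fun l hl => funext fun v => (hLe hl v).symm
  · rintro hx b -
    refine ⟨fun g hg => ?_, fun c hc => ?_⟩
    · obtain ⟨v, hv, rfl⟩ := List.mem_map.1 hg
      have hvL : v ∈ L := hL ▸ AddSubgroup.subset_closure hv
      rw [symbolAt_ofFn (e := e) hM, symbolAt_nil (e := e) hM, add_comm,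
        le_periods_of_mem hx hvL]
    · obtain ⟨P, hP, hcP⟩ := exists_right_of_forall₂ hF hc
      rw [Bool.eq_false_iff, Ne, matchesAt_iff hM n _ hcP]
      have hxY := hx.1
      rw [hY] at hxY
      exact hxY P hP _

end Semantics

/-! ### Rescaling the table values to natural numbers. -/

section Values

lemma dvd_commonDen {cf : List (PatternCode × RatCode)} {t : PatternCode × RatCode}
    (ht : t ∈ cf) : t.2.2 ∣ commonDen cf :=
  List.dvd_prod (List.mem_map_of_mem (f := fun t : PatternCode × RatCode => t.2.2) ht)

lemma commonDen_ne_zero {cf : List (PatternCode × RatCode)} (h : ∀ t ∈ cf, t.2.2 ≠ 0) :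
    commonDen cf ≠ 0 := by
  refine List.prod_ne_zero fun h0 => ?_
  obtain ⟨t, ht, h1⟩ := List.mem_map.1 h0
  exact h t ht h1

/-- The offset dominates the subtracted term, so the natural subtraction does not truncate; the
division is exact because the denominator divides `commonDen cf`. -/
lemma scaledValue_cast {cf : List (PatternCode × RatCode)} {t : PatternCode × RatCode}
    (ht : t ∈ cf) {q : ℚ} (hq : RatCode.Describes t.2 q) :
    (scaledValue cf t.2 : ℚ) = offset cf + commonDen cf * q := by
  obtain ⟨hden, rfl⟩ := hq
  have hoff : (-t.2.1).toNat * (commonDen cf / t.2.2) ≤ offset cf := by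
    refine (Nat.mul_le_mul_left _ (Nat.div_le_self _ _)).trans ?_
    exact List.single_le_sum (fun _ _ => Nat.zero_le _) _
      (List.mem_map_of_mem (f := fun t : PatternCode × RatCode =>
        (-t.2.1).toNat * commonDen cf) ht)
  obtain ⟨m, hm⟩ := dvd_commonDen ht
  have hdiv : commonDen cf / t.2.2 = m := by
    rw [hm, Nat.mul_div_cancel_left _ (Nat.pos_of_ne_zero hden)]
  have hz : ((t.2.1.toNat : ℤ) : ℚ) - (((-t.2.1).toNat : ℤ) : ℚ) = (t.2.1 : ℚ) := by
    rw [← Int.cast_sub, Int.toNat_sub_toNat_neg]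
  have hden' : (t.2.2 : ℚ) ≠ 0 := by exact_mod_cast hden
  rw [scaledValue, Nat.cast_sub (hoff.trans (Nat.le_add_right _ _)), hdiv, hm]
  push_cast at hz ⊢
  rw [← hz]
  field_simp
  ring

/-- Patterns of a table may overlap. The first match decides, harmlessly, since all matches carry
the same value; the default `0` is never reached. -/
lemma foldr_cond_eq {α : Type*} {p : α → Bool} {v : α → ℕ} {r : ℕ} {l : List α}
    (hex : ∃ t ∈ l, p t = true) (hv : ∀ t ∈ l, p t = true → v t = r) :
    l.foldr (fun t s => bif p t then v t else s) 0 = r := by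
  induction l with
  | nil => simp at hex
  | cons a l ih =>
    rw [List.foldr_cons]
    cases hp : p a with
    | true => simpa using hv a List.mem_cons_self hp
    | false =>
      refine ih ?_ fun t ht => hv t (List.mem_cons_of_mem _ ht)
      obtain ⟨t, ht, hpt⟩ := hex
      rcases List.mem_cons.1 ht with rfl | ht
      · simp [hp] at hpt
      · exact ⟨t, ht, hpt⟩

variable {d k : ℕ} {A : Type*} [Inhabited A] [TopologicalSpace A] {e : A ≃ Fin k} [NeZero k]
  {M : ℕ}

lemma cellValue_cast (hM : 0 < M) {n : ℕ} (b : ℕ) {Y : Subshift A (Fin d → ℤ)}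
    {f : Y.carrier → ℚ} {cf : List (PatternCode × RatCode)} (hf : DescribesFun e cf Y f)
    (hn : indexedConfig e M n ∈ Y.carrier) :
    (cellValue d k M cf n b : ℝ) =
      offset cf + commonDen cf * extendZero Y f (shift (indexPoint d M b) (indexedConfig e M n)) := by
  obtain ⟨T, hT, hcover, hvalue⟩ := hf
  have hx := Y.mapsTo (indexPoint d M b) hn
  rw [extendZero_of_mem hx]
  set x : Y.carrier := ⟨shift (indexPoint d M b) (indexedConfig e M n), hx⟩ with hxdef
  have hocc : ∀ (c : PatternCode) (P : Pattern A (Fin d → ℤ)), PatternCode.Describes e c P →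
      (matchesAt d k M n b c = true ↔ P.occursInAt x.1 0) := by
    intro c P hcP
    rw [matchesAt_iff hM n b hcP, hxdef, Pattern.occursInAt_shift, add_zero]
  have hval : ∀ t ∈ cf, matchesAt d k M n b t.1 = true →
      (scaledValue cf t.2 : ℚ) = offset cf + commonDen cf * f x := by
    intro t ht hm
    obtain ⟨s, hs, hts⟩ := exists_right_of_forall₂ hT ht
    rw [hvalue x s hs ((hocc _ _ hts.1).1 hm)]
    exact scaledValue_cast ht hts.2
  obtain ⟨s, hs, hso⟩ := hcover x
  obtain ⟨t, ht, hts⟩ := exists_left_of_forall₂ hT hs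
  have hm := (hocc _ _ hts.1).2 hso
  have hcell : cellValue d k M cf n b = scaledValue cf t.2 := by
    refine foldr_cond_eq ⟨t, ht, hm⟩ fun t' ht' hm' => ?_
    have := (hval t' ht' hm').trans (hval t ht hm).symm
    exact_mod_cast this
  rw [hcell]
  exact_mod_cast congrArg (Rat.cast : ℚ → ℝ) (hval t ht hm)

lemma totalValue_cast [NeZero M] {n : ℕ} {Y : Subshift A (Fin d → ℤ)}
    {f : Y.carrier → ℚ} {cf : List (PatternCode × RatCode)} (hf : DescribesFun e cf Y f)
    (hn : indexedConfig e M n ∈ Y.carrier) :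
    (totalValue d k M cf n : ℝ) = offset cf * (M : ℝ) ^ d +
      commonDen cf * (M : ℝ) ^ d * periodicAverage Y f M (indexedConfig e M n) := by
  have hM : 0 < M := Nat.pos_of_ne_zero (NeZero.ne M)
  have h1 : totalValue d k M cf n = ∑ b ∈ Finset.range (M ^ d), cellValue d k M cf n b := by
    simp [totalValue, Finset.sum, Finset.range, Multiset.range]
  have hM0 : (M : ℝ) ^ d ≠ 0 := pow_ne_zero _ (by exact_mod_cast hM.ne')
  rw [h1, Nat.cast_sum, Finset.sum_congr rfl fun b _ => cellValue_cast hM b hf hn,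
    Finset.sum_add_distrib, ← Finset.mul_sum, periodicAverage,
    sum_residueVec_eq_sum_range (fun v => extendZero Y f (shift v (indexedConfig e M n)))]
  simp only [Finset.sum_const, Finset.card_range, nsmul_eq_mul, Nat.cast_pow]
  field_simp

end Values

/-! ### Code numbers bound everything they encode. -/

section Encoding

open Encodable

lemma encode_le_encode_of_mem {α : Type*} [Encodable α] {l : List α} {a : α} (h : a ∈ l) :
    encode a ≤ encode l := by
  induction l with
  | nil => simp at h
  | cons b l ih =>
    rw [encode_list_cons]
    rcases List.mem_cons.1 h with rfl | h
    · exact (Nat.left_le_pair _ _).trans (Nat.le_succ _)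
    · exact (ih h).trans ((Nat.right_le_pair _ _).trans (Nat.le_succ _))

lemma encode_fst_le {α β : Type*} [Encodable α] [Encodable β] (x : α × β) :
    encode x.1 ≤ encode x := Nat.left_le_pair _ _

lemma encode_snd_le {α β : Type*} [Encodable α] [Encodable β] (x : α × β) :
    encode x.2 ≤ encode x := Nat.right_le_pair _ _

lemma abs_le_encode (z : ℤ) : |z| ≤ (encode z + 1 : ℕ) := by
  rcases z with n | n
  · have : encode (Int.ofNat n) = 2 * n := rfl
    rw [this, Int.ofNat_eq_natCast, abs_of_nonneg (Int.natCast_nonneg n)]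
    push_cast
    omega
  · have : encode (Int.negSucc n) = 2 * n + 1 := rfl
    rw [this, abs_of_neg (Int.negSucc_lt_zero n)]
    push_cast
    omega

lemma abs_le_encode_ofFn {d : ℕ} (v : Fin d → ℤ) (j : Fin d) :
    |v j| ≤ (encode (List.ofFn v) + 1 : ℕ) := by
  refine (abs_le_encode (v j)).trans ?_
  have h := encode_le_encode_of_mem (List.mem_ofFn.2 ⟨j, rfl⟩ : v j ∈ List.ofFn v)
  exact_mod_cast Nat.succ_le_succ h

lemma PatternCode.Describes.bound {d k : ℕ} {A : Type*} [Inhabited A] {e : A ≃ Fin k}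
    {c : PatternCode} {P : Pattern A (Fin d → ℤ)} (h : PatternCode.Describes e c P)
    {v : Fin d → ℤ} (hv : v ∈ P.support) (j : Fin d) : |v j| ≤ (encode c + 1 : ℕ) := by
  refine (abs_le_encode_ofFn v j).trans ?_
  have h1 := encode_le_encode_of_mem ((h _).2 ⟨v, hv, rfl⟩)
  have h2 := (encode_fst_le (List.ofFn v, (e (P.config v) : ℕ))).trans h1
  exact_mod_cast Nat.succ_le_succ h2

end Encoding

/-! ### Correctness of the algorithm and the final theorem. -/

section Main

open Encodable

/-- The algorithm returns the minimum density on every description of the data, and this minimum is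
attained. -/
theorem minDensityAlgorithm_spec {c : ℕ} {A : Type*} [Finite A] [Inhabited A] [TopologicalSpace A]
    [DiscreteTopology A] {Y : Subshift A (Fin (c + 1) → ℤ)} {f : Y.carrier → ℚ}
    {L : AddSubgroup (Fin (c + 1) → ℤ)} (hL : Module.finrank ℤ L = c)
    (hne : (periodicPart Y L).carrier.Nonempty) {w : InputCode} (hw : Describes w Y f L) :
    ∃ r ∈ minDensityAlgorithm w, ∃ q : ℚ, RatCode.Describes r q ∧
      (∃ x : (periodicPart Y L).carrier,
        HasDensity (periodicPart Y L) (restrictPeriodic Y L f) x (q : ℝ)) ∧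
      ∀ (x : (periodicPart Y L).carrier) (a : ℝ),
        HasDensity (periodicPart Y L) (restrictPeriodic Y L f) x a → (q : ℝ) ≤ a := by
  obtain ⟨k, e, cY, cf, cL, hweq, ⟨F, hF, hYF⟩, hfun, G, rfl, hG⟩ := hw
  have hfun' := hfun
  obtain ⟨T, hT, hcover, hvalue⟩ := hfun'
  have hk : NeZero k := ⟨by rintro rfl; exact (e default).elim0⟩
  -- Pairing dominates both components, so this number bounds the dimension, the alphabet size and
  -- every coordinate in the input; the `+ 1` is for negative integers, as `-1` has code `1` but
  -- `-2` only `3`, and for the uniform bound `abs_le_encode`.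
  set R := encode w + 1 with hR
  have hM0 : 0 < inputPeriod w := commonPeriod_pos R
  have hM : NeZero (inputPeriod w) := ⟨hM0.ne'⟩
  have hM' : NeZero (commonPeriod R) := hM
  have e1 : encode w.2 ≤ encode w := encode_snd_le w
  have e2 : encode w.2.2 ≤ encode w := (encode_snd_le w.2).trans e1
  have e3 : encode w.2.2.2 ≤ encode w := (encode_snd_le w.2.2).trans e2
  have hd : c + 1 ≤ encode w := by
    have := encode_fst_le w
    rwa [hweq] at this ⊢
  have hkR : k ≤ encode w := by
    have := (encode_fst_le w.2).trans e1
    rwa [hweq] at this ⊢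
  have hcY : encode cY ≤ encode w := by
    have := (encode_fst_le w.2.2).trans e2
    rwa [hweq] at this ⊢
  have hcf : encode cf ≤ encode w := by
    have := (encode_fst_le w.2.2.2).trans e3
    rwa [hweq] at this ⊢
  have hcL : encode (G.map List.ofFn) ≤ encode w := by
    have := (encode_snd_le w.2.2.2).trans e3
    rwa [hweq] at this ⊢
  have hP : IsPresentation Y f F T R := by
    refine ⟨hYF, hcover, hvalue, fun P hP v hv j => ?_, fun t ht v hv j => ?_⟩
    · obtain ⟨p, hp, hpP⟩ := exists_left_of_forall₂ hF hP
      refine (hpP.bound hv j).trans ?_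
      exact_mod_cast Nat.succ_le_succ ((encode_le_encode_of_mem hp).trans hcY)
    · obtain ⟨s, hs, hst⟩ := exists_left_of_forall₂ hT ht
      refine (hst.1.bound hv j).trans ?_
      exact_mod_cast Nat.succ_le_succ
        (((encode_fst_le s).trans (encode_le_encode_of_mem hs)).trans hcf)
  have hGR : ∀ g ∈ {v | v ∈ G}, ∀ j, |g j| ≤ (R : ℤ) := by
    intro g hg j
    refine (abs_le_encode_ofFn g j).trans ?_
    exact_mod_cast Nat.succ_le_succ
      ((encode_le_encode_of_mem (List.mem_map_of_mem (f := List.ofFn) hg)).trans hcL)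
  have hA : Nat.card A ≤ R := by
    rw [Nat.card_congr e, Nat.card_eq_fintype_card, Fintype.card_fin]
    omega
  obtain ⟨⟨y, hy, hyper⟩, hmin⟩ := commonPeriod_spec hP hL hG hGR (by omega) hA hne
  have hatt : ∀ s, isAttained w (inputPeriod w) s = true ↔ ∃ n < k ^ inputPeriod w ^ (c + 1),
      indexedConfig e (inputPeriod w) n ∈ (periodicPart Y L).carrier ∧
        totalValue (c + 1) k (inputPeriod w) cf n = s := by
    intro s
    have h1 : isAttained w (inputPeriod w) s = isAttained (c + 1, k, cY, cf, G.map List.ofFn)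
      (inputPeriod w) s := by rw [← hweq]
    rw [h1, isAttained, decide_eq_true_iff]
    simp only [List.mem_range, isValid_iff hM0 _ hF hYF hG]
  obtain ⟨n₀, hn₀, rfl⟩ := hyper.exists_index (e := e) hM0
  -- The search halts: the `commonPeriod R`-periodic configuration in `Y_L` supplied by
  -- `commonPeriod_spec` has a total value that passes the test.
  obtain ⟨s, hs, -⟩ := Nat.rfind_min' (p := isAttained w (inputPeriod w))
    ((hatt _).2 ⟨n₀, hn₀, hy, rfl⟩)
  obtain ⟨hs1, hs2⟩ := Nat.mem_rfind.1 hs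
  simp only [PFun.coe_val, Part.mem_some_iff] at hs1 hs2
  obtain ⟨n, hn, hnY, hns⟩ := (hatt s).1 hs1.symm
  have hDn : (commonDen cf : ℝ) * (inputPeriod w : ℝ) ^ (c + 1) ≠ 0 := by
    refine mul_ne_zero ?_ (pow_ne_zero _ (by exact_mod_cast hM0.ne'))
    exact_mod_cast commonDen_ne_zero fun t ht =>
      (exists_right_of_forall₂ hT ht).choose_spec.2.2.1
  have hDn_nonneg : 0 ≤ (commonDen cf : ℝ) * (inputPeriod w : ℝ) ^ (c + 1) :=
    mul_nonneg (Nat.cast_nonneg _) (pow_nonneg (Nat.cast_nonneg _) _)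
  set q : ℚ := (((s : ℤ) - ((offset cf * inputPeriod w ^ (c + 1) : ℕ) : ℤ) : ℤ) : ℚ) /
    ((commonDen cf * inputPeriod w ^ (c + 1) : ℕ) : ℚ) with hq
  have hqR : (q : ℝ) = ((s : ℝ) - offset cf * (inputPeriod w : ℝ) ^ (c + 1)) /
      (commonDen cf * (inputPeriod w : ℝ) ^ (c + 1)) := by
    rw [hq]; push_cast; ring
  refine ⟨_, Part.mem_map _ hs, q, ⟨?_, ?_⟩, ⟨⟨_, hnY⟩, ?_⟩, ?_⟩
  · rw [hweq] at hDn ⊢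
    exact_mod_cast hDn
  · rw [hweq] at hq ⊢
    exact hq
  · have h1 := hasDensity_periodicAverage hP ⟨_, hnY⟩ (indexedConfig_isPeriodicMod hM0 n)
    have h2 := totalValue_cast (e := e) (M := inputPeriod w) hfun hnY.1
    rw [hns] at h2
    have h3 : (q : ℝ) = periodicAverage Y f (inputPeriod w) (indexedConfig e (inputPeriod w) n) := by
      rw [hqR, div_eq_iff hDn, h2]; ring
    rw [h3]
    exact h1
  · refine hmin q fun x hx hxper => ?_
    obtain ⟨m, hm, rfl⟩ := hxper.exists_index (e := e) hM0
    have hsm : s ≤ totalValue (c + 1) k (inputPeriod w) cf m := by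
      by_contra! hlt
      have h1 := hs2 hlt
      rw [(hatt _).2 ⟨m, hm, hx, rfl⟩] at h1
      exact Bool.false_ne_true h1
    have h2 := totalValue_cast (e := e) (M := inputPeriod w) hfun hx.1
    have h3 : (s : ℝ) ≤ totalValue (c + 1) k (inputPeriod w) cf m := Nat.cast_le.2 hsm
    rw [hqR, div_le_iff₀ (lt_of_le_of_ne hDn_nonneg hDn.symm)]
    rw [h2] at h3
    change _ ≤ periodicAverage Y f (inputPeriod w) _ * _
    linarith

lemma density_eq {d : ℕ} {A : Type*} [TopologicalSpace A] {X : Subshift A (Fin d → ℤ)}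
    {f : X.carrier → ℝ} {x : X.carrier} {a : ℝ} (h : HasDensity X f x a) :
    density X f x = (a : EReal) := by
  have hex : ∃ a : ℝ, HasDensity X f x a := ⟨a, h⟩
  rw [density, dif_pos hex, tendsto_nhds_unique hex.choose_spec h]

/-- Configurations without a density have value `⊤` and do not affect the infimum. -/
lemma minDensity_eq {d : ℕ} {A : Type*} [TopologicalSpace A] {X : Subshift A (Fin d → ℤ)}
    {f : X.carrier → ℝ} {a : ℝ} (hx : ∃ x, HasDensity X f x a)
    (hmin : ∀ x b, HasDensity X f x b → a ≤ b) : minDensity X f = (a : EReal) := by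
  obtain ⟨x, hx⟩ := hx
  refine le_antisymm ((iInf_le _ x).trans_eq (density_eq hx)) (le_iInf fun y => ?_)
  by_cases hy : ∃ b : ℝ, HasDensity X f y b
  · obtain ⟨b, hb⟩ := hy
    rw [density_eq hb]
    exact_mod_cast hmin y b hb
  · rw [density, dif_neg hy]
    exact le_top

end Main

end PeriodicDensity

theorem lemma4 :
    ∃ Φ : PeriodicDensity.InputCode →. PeriodicDensity.RatCode, Partrec Φ ∧
      ∀ (d : ℕ) (A : Type u) [Finite A] [Inhabited A] [TopologicalSpace A] [DiscreteTopology A]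
        (Y : Subshift A (Fin d → ℤ)) (f : Y.carrier → ℚ) (L : AddSubgroup (Fin d → ℤ)),
        PeriodicDensity.IsSFT Y →
        PeriodicDensity.IsSimpleContinuous f →
        Module.finrank ℤ L + 1 = d →
        (PeriodicDensity.periodicPart Y L).carrier.Nonempty →
        ∃ q : ℚ,
          PeriodicDensity.minDensity (PeriodicDensity.periodicPart Y L)
              (PeriodicDensity.restrictPeriodic Y L f) = (((q : ℚ) : ℝ) : EReal) ∧
          (∃ x : (PeriodicDensity.periodicPart Y L).carrier,
            PeriodicDensity.HasDensity (PeriodicDensity.periodicPart Y L)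
              (PeriodicDensity.restrictPeriodic Y L f) x (q : ℝ)) ∧
          ∀ w : PeriodicDensity.InputCode, PeriodicDensity.Describes w Y f L →
            ∃ r ∈ Φ w, PeriodicDensity.RatCode.Describes r q := by
  refine ⟨PeriodicDensity.minDensityAlgorithm, PeriodicDensity.partrec_minDensityAlgorithm, ?_⟩
  intro d A _ _ _ _ Y f L hY hf hd hne
  obtain ⟨c, rfl⟩ : ∃ c, d = c + 1 := ⟨_, hd.symm⟩
  have hL : Module.finrank ℤ L = c := by omega
  -- Some description is needed to produce `q`. Any other description yields a number that is also
  -- an attained lower bound for the densities, hence the same one.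
  obtain ⟨w₀, hw₀⟩ := PeriodicDensity.exists_describes L hY hf
  obtain ⟨-, -, q, -, hatt, hmin⟩ := PeriodicDensity.minDensityAlgorithm_spec hL hne hw₀
  refine ⟨q, PeriodicDensity.minDensity_eq hatt hmin, hatt, fun w hw => ?_⟩
  obtain ⟨r, hr, q', hrq, ⟨x', hx'⟩, hmin'⟩ :=
    PeriodicDensity.minDensityAlgorithm_spec hL hne hw
  obtain ⟨x, hx⟩ := hatt
  have hqq : q = q' := by
    exact_mod_cast le_antisymm (hmin x' q' hx') (hmin' x q hx)
  exact ⟨r, hr, hqq ▸ hrq⟩
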